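/- Let $N\ge 2$, let $\Omega\subset\mathbb{R}^N$ be a bounded open set, and let $K\subset\mathbb{R}^N$ be a compact convex set with $0\in\operatorname{int}K$ and gauge function $\rho_K(\xi)=\inf\{t\ge 0:\ \xi\in tK\}$. For $1\le p<\infty$, $W^{1,p}_0(\Omega)$ is the closure of $C_c^\infty(\Omega)$ in $W^{1,p}(\Omega)$, and $W^{1,\infty}_0(\Omega)=W^{1,\infty}(\Omega)\cap\bigcap_{1\le p<\infty}W^{1,p}_0(\Omega)$ (the Lipschitz functions on $\overline\Omega$ that vanish on $\partial\Omega$). Functionals $F_p$ on a metric space $X$ are said to $\Gamma$-converge to $F$ as $p\to\infty$ if for every $v\in X$ there are $v_p\to v$ with $\limsup_{p\to\infty}F_p(v_p)\le F(v)$, and $\liminf_{p\to\infty}F_p(v_p)\ge F(v)$ whenever $v_p\to v$. (1) Let $$G_p(v)=\begin{cases}\int_\Omega \frac1p\,\rho_K(Dv)^p\,dx & v\in W^{1,p}_0(\Omega)\\ +\infty&\text{otherwise,}\end{cases}\qquad G(v)=\begin{cases}0 & v\in W^{1,\infty}_0(\Omega),\ Dv\in K\text{ a.e. in }\Omega\\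 +\infty&\text{otherwise.}\end{cases}$$ Then $G_p$ $\Gamma$-converges to $G$ in $L^r(\Omega)$, as $p\to\infty$, for every $1\le r\le\infty$. (2) Let $\bar u\in L^2(\Omega)$, let $I_K=0$ on $K$ and $I_K=+\infty$ off $K$, and for $v\in L^2(\Omega)$ let $$J_p(v)=\begin{cases}\int_\Omega \left[\frac1p\,\rho_K(Dv)^p+(v-\bar u)^2\right]dx & v\in W^{1,p}_0(\Omega)\\ +\infty&\text{otherwise,}\end{cases}\qquad J(v)=\begin{cases}\int_\Omega \left[I_K(Dv)+(v-\bar u)^2\right]dx & v\in W^{1,s}_0(\Omega)\\ +\infty&\text{otherwise,}\end{cases}$$ where either $s=\infty$, or $s=1$ and every ball centred at a point of $\partial\Omega$ meets $\mathbb{R}^N\setminus\Omega$ in a set of positive Lebesgue measure (as is the case for every Lipschitz domain). Then $J_p$ $\Gamma$-converges to $J$ in $L^2(\Omega)$ as $p\to\infty$. (3) If in addition $\bar u\in c_0+W^{1,\infty}_0(\Omega)$ for some $c_0\in\mathbb{R}$ and $\rho_K(D\bar u)\le 1$ a.e. in $\Omega$, then $J_p$ has a unique minimizer $u_p$ in $L^2(\Omega)$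 for every $p>1$, $J$ has a unique minimizer $u$ in $L^2(\Omega)$, and, as $p\to\infty$, $u_p$ converges to $u$ in the weak topology of $W^{1,q}_0(\Omega)$ for every $1<q<\infty$. -/

import Mathlib

open MeasureTheory Filter Topology Set
open scoped ENNReal ContDiff

noncomputable section

namespace SobolevGamma

/-- Sequential `Γ`-convergence of the functionals `F i`, along the filter `l`, to `F₀`. -/
def GammaTendsto {ι X : Type*} [TopologicalSpace X] (l : Filter ι) (F : ι → X → ℝ≥0∞)
    (F₀ : X → ℝ≥0∞) : Prop :=
  (∀ v : X, ∃ w : ι → X, Tendsto w l (𝓝 v) ∧ limsup (fun i => F i (w i)) l ≤ F₀ v) ∧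
  (∀ (v : X) (w : ι → X), Tendsto w l (𝓝 v) → F₀ v ≤ liminf (fun i => F i (w i)) l)

/-- `u` is a global minimizer of `F`. -/
def IsMinimizer {X : Type*} (F : X → ℝ≥0∞) (u : X) : Prop := ∀ v, F u ≤ F v

variable {N : ℕ}

/-- `φ` is a test function on `Ω`: smooth, with compact support contained in `Ω`. -/
def IsTest (Ω : Set (EuclideanSpace ℝ (Fin N))) (φ : EuclideanSpace ℝ (Fin N) → ℝ) : Prop :=
  ContDiff ℝ ∞ φ ∧ HasCompactSupport φ ∧ tsupport φ ⊆ Ω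

/-- `g` is the weak gradient of `v` in the open set `Ω`. -/
def HasWeakGradient (Ω : Set (EuclideanSpace ℝ (Fin N))) (v : EuclideanSpace ℝ (Fin N) → ℝ)
    (g : EuclideanSpace ℝ (Fin N) → EuclideanSpace ℝ (Fin N)) : Prop :=
  LocallyIntegrableOn v Ω ∧ LocallyIntegrableOn g Ω ∧
    ∀ φ, IsTest Ω φ → ∫ x in Ω, v x • gradient φ x = - ∫ x in Ω, φ x • g x

open Classical in
/-- The weak gradient `Dv` of `v` in `Ω` (a representative of it; zero if there is none). -/
def weakGradient (Ω : Set (EuclideanSpace ℝ (Fin N))) (v : EuclideanSpace ℝ (Fin N) → ℝ) :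
    EuclideanSpace ℝ (Fin N) → EuclideanSpace ℝ (Fin N) :=
  if h : ∃ g, HasWeakGradient Ω v g then h.choose else 0

/-- `v ∈ W^{1,p}(Ω)`. -/
def MemSobolev (Ω : Set (EuclideanSpace ℝ (Fin N))) (p : ℝ≥0∞)
    (v : EuclideanSpace ℝ (Fin N) → ℝ) : Prop :=
  MemLp v p (volume.restrict Ω) ∧
    ∃ g, MemLp g p (volume.restrict Ω) ∧ HasWeakGradient Ω v g

theorem IsTest.zero (Ω : Set (EuclideanSpace ℝ (Fin N))) : IsTest Ω 0 :=
  ⟨contDiff_const, HasCompactSupport.zero, by simp [tsupport]⟩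

theorem IsTest.add {Ω : Set (EuclideanSpace ℝ (Fin N))} {φ ψ : EuclideanSpace ℝ (Fin N) → ℝ}
    (h : IsTest Ω φ) (k : IsTest Ω ψ) : IsTest Ω (φ + ψ) :=
  ⟨h.1.add k.1, h.2.1.add k.2.1,
    (tsupport_add φ ψ).trans (union_subset h.2.2 k.2.2)⟩

theorem IsTest.const_smul {Ω : Set (EuclideanSpace ℝ (Fin N))}
    {φ : EuclideanSpace ℝ (Fin N) → ℝ} (c : ℝ) (h : IsTest Ω φ) : IsTest Ω (c • φ) :=
  ⟨h.1.const_smul c, h.2.1.smul_left (f := fun _ => c),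
    (closure_mono (Function.support_const_smul_subset c φ)).trans h.2.2⟩

theorem IsTest.differentiableAt {Ω : Set (EuclideanSpace ℝ (Fin N))}
    {φ : EuclideanSpace ℝ (Fin N) → ℝ} (h : IsTest Ω φ) (x : EuclideanSpace ℝ (Fin N)) :
    DifferentiableAt ℝ φ x :=
  (h.1.differentiable (by simp)).differentiableAt

/-- The pairs `(φ, ∇φ)`, `φ` a test function on `Ω`, in `L^p(Ω) × L^p(Ω; ℝ^N)`. -/
def testPairs (Ω : Set (EuclideanSpace ℝ (Fin N))) (p : ℝ≥0∞) [Fact (1 ≤ p)] :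
    Submodule ℝ (Lp ℝ p (volume.restrict Ω) ×
      Lp (EuclideanSpace ℝ (Fin N)) p (volume.restrict Ω)) where
  carrier := {w | ∃ φ, IsTest Ω φ ∧ w.1 =ᵐ[volume.restrict Ω] φ ∧
    w.2 =ᵐ[volume.restrict Ω] gradient φ}
  zero_mem' := by
    refine ⟨0, IsTest.zero Ω, Lp.coeFn_zero _ _ _, ?_⟩
    have h : gradient (0 : EuclideanSpace ℝ (Fin N) → ℝ) = 0 := by
      funext x
      simp [gradient]
    rw [h]
    exact Lp.coeFn_zero _ _ _
  add_mem' := by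
    rintro a b ⟨φ, hφ, h1, h2⟩ ⟨ψ, hψ, k1, k2⟩
    refine ⟨φ + ψ, hφ.add hψ, (Lp.coeFn_add _ _).trans (h1.add k1), ?_⟩
    have h : gradient (φ + ψ) = gradient φ + gradient ψ := by
      funext x
      simp [gradient, fderiv_add (hφ.differentiableAt x) (hψ.differentiableAt x)]
    rw [h]
    exact (Lp.coeFn_add _ _).trans (h2.add k2)
  smul_mem' := by
    rintro c a ⟨φ, hφ, h1, h2⟩
    refine ⟨c • φ, hφ.const_smul c, (Lp.coeFn_smul _ _).trans (h1.const_smul c), ?_⟩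
    have h : gradient (c • φ) = c • gradient φ := by
      funext x
      simp [gradient, fderiv_const_smul (hφ.differentiableAt x) c]
    rw [h]
    exact (Lp.coeFn_smul _ _).trans (h2.const_smul c)

/-- For `1 ≤ p < ∞`, the Banach space `W^{1,p}_0(Ω)`: the closure of the test functions on `Ω`
for the norm of `W^{1,p}(Ω)`. A function `v` is carried as the pair `(v, Dv)`, with the norm
`max (‖v‖_p) (‖Dv‖_p)`. -/
def sobolevZero (Ω : Set (EuclideanSpace ℝ (Fin N))) (p : ℝ≥0∞) [Fact (1 ≤ p)] :
    Submodule ℝ (Lp ℝ p (volume.restrict Ω) ×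
      Lp (EuclideanSpace ℝ (Fin N)) p (volume.restrict Ω)) :=
  (testPairs Ω p).topologicalClosure

/-- `v ∈ W^{1,p}_0(Ω)`, `1 ≤ p < ∞`. -/
def MemSobolevZeroFin (Ω : Set (EuclideanSpace ℝ (Fin N))) (p : ℝ≥0∞)
    (v : EuclideanSpace ℝ (Fin N) → ℝ) : Prop :=
  ∃ (_ : Fact (1 ≤ p)) (w : sobolevZero Ω p), w.1.1 =ᵐ[volume.restrict Ω] v

open Classical in
/-- `v ∈ W^{1,p}_0(Ω)`, `1 ≤ p ≤ ∞`, where `W^{1,∞}_0(Ω)` consists of the functions of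
`W^{1,∞}(Ω)` that belong to `W^{1,q}_0(Ω)` for every finite `q`; for a bounded open set these are
the Lipschitz functions that vanish on the boundary. -/
def MemSobolevZero (Ω : Set (EuclideanSpace ℝ (Fin N))) (p : ℝ≥0∞)
    (v : EuclideanSpace ℝ (Fin N) → ℝ) : Prop :=
  if p = ⊤ then
    MemSobolev Ω ⊤ v ∧ ∀ q : ℝ≥0∞, 1 ≤ q → q ≠ ⊤ → MemSobolevZeroFin Ω q v
  else MemSobolevZeroFin Ω p v

open Classical in
/-- `G_p(v) = ∫_Ω (1/p) ρ_K(Dv)^p dx` on `W^{1,p}_0(Ω)`, and `+∞` elsewhere. -/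
def powerEnergy (Ω K : Set (EuclideanSpace ℝ (Fin N))) (p : ℝ)
    (v : EuclideanSpace ℝ (Fin N) → ℝ) : ℝ≥0∞ :=
  if MemSobolevZero Ω (ENNReal.ofReal p) v then
    ∫⁻ x in Ω, ENNReal.ofReal (1 / p * gauge K (weakGradient Ω v x) ^ p)
  else ⊤

open Classical in
/-- `G(v) = 0` if `v ∈ W^{1,∞}_0(Ω)` and `Dv ∈ K` almost everywhere, and `+∞` otherwise. -/
def constraintEnergy (Ω K : Set (EuclideanSpace ℝ (Fin N)))
    (v : EuclideanSpace ℝ (Fin N) → ℝ) : ℝ≥0∞ :=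
  if MemSobolevZero Ω ⊤ v ∧ ∀ᵐ x ∂(volume.restrict Ω), weakGradient Ω v x ∈ K then 0 else ⊤

open Classical in
/-- `J_p(v) = ∫_Ω [(1/p) ρ_K(Dv)^p + (v - ū)^2] dx` on `W^{1,p}_0(Ω)`, and `+∞` elsewhere. -/
def powerFidelity (Ω K : Set (EuclideanSpace ℝ (Fin N))) (ubar : EuclideanSpace ℝ (Fin N) → ℝ)
    (p : ℝ) (v : EuclideanSpace ℝ (Fin N) → ℝ) : ℝ≥0∞ :=
  if MemSobolevZero Ω (ENNReal.ofReal p) v then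
    ∫⁻ x in Ω, ENNReal.ofReal (1 / p * gauge K (weakGradient Ω v x) ^ p + (v x - ubar x) ^ 2)
  else ⊤

open Classical in
/-- The indicator function `I_K`: `0` on `K` and `+∞` elsewhere. -/
def indicatorFun (K : Set (EuclideanSpace ℝ (Fin N))) (ξ : EuclideanSpace ℝ (Fin N)) : ℝ≥0∞ :=
  if ξ ∈ K then 0 else ⊤

open Classical in
/-- `J(v) = ∫_Ω [I_K(Dv) + (v - ū)^2] dx` on `W^{1,s}_0(Ω)`, and `+∞` elsewhere. -/
def constraintFidelity (Ω K : Set (EuclideanSpace ℝ (Fin N)))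
    (ubar : EuclideanSpace ℝ (Fin N) → ℝ) (s : ℝ≥0∞)
    (v : EuclideanSpace ℝ (Fin N) → ℝ) : ℝ≥0∞ :=
  if MemSobolevZero Ω s v then
    ∫⁻ x in Ω, (indicatorFun K (weakGradient Ω v x) + ENNReal.ofReal ((v x - ubar x) ^ 2))
  else ⊤

/-- Every ball centred on the boundary of `Ω` meets the complement of `Ω` in a set of positive
measure. -/
def ThickComplement (Ω : Set (EuclideanSpace ℝ (Fin N))) : Prop :=
  ∀ x ∈ frontier Ω, ∀ r > 0, 0 < volume (Metric.ball x r \ Ω)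

/-- Weak convergence of `u i` to `u₀` in the Banach space `W^{1,q}_0(Ω)` along `l`; the functions
`u i` have to lie in the space for all `i` far enough along `l`. -/
def WeakTendstoSobolevZero {ι : Type*} (Ω : Set (EuclideanSpace ℝ (Fin N))) (q : ℝ≥0∞)
    [Fact (1 ≤ q)] (l : Filter ι) (u : ι → EuclideanSpace ℝ (Fin N) → ℝ)
    (u₀ : EuclideanSpace ℝ (Fin N) → ℝ) : Prop :=
  ∃ (w : ι → sobolevZero Ω q) (w₀ : sobolevZero Ω q),
    (∀ᶠ i in l, (w i).1.1 =ᵐ[volume.restrict Ω] u i) ∧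
    w₀.1.1 =ᵐ[volume.restrict Ω] u₀ ∧
    Tendsto (fun i => toWeakSpace ℝ (sobolevZero Ω q) (w i)) l
      (𝓝 (toWeakSpace ℝ (sobolevZero Ω q) w₀))

end SobolevGamma

end

/-!
The whole proof rests on the monotonicity of the functionals in the exponent: by Young's inequality
`t ^ r / r - 1 / r ≤ t ^ s / s - 1 / s` for `r ≤ s`, so that `G_r - |Ω| / r` and `J_r - |Ω| / r` are
nondecreasing in `r` (`energy_le_energy_add`). A bound for the energies at exponents tending to
infinity is thus a bound at every fixed exponent.

*Recovery sequences.* They are constant: if `Dv ∈ K` almost everywhere then `ρ_K(Dv) ≤ 1`, and the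
gradient term is at most `|Ω| / p` (`Admissible.limsup_energy_le`).

*Lower bound.* Let `v_p → v` with energies bounded along some sequence `p → ∞`. For every fixed
exponent `r` the energies of exponent `r` are then bounded, and lower semicontinuity bounds the
energy of `v` itself, uniformly in `r` (`energy_le_of_tendsto`). By Chebyshev's inequality,
`∫ ρ_K(Dv) ^ r / r ≤ c` for all `r` forces `ρ_K(Dv) ≤ 1`, that is, `Dv ∈ K`. Poincaré's inequality
holds with a constant that does not depend on the exponent, so the same argument bounds `v`, and
`v ∈ W^{1,∞}_0(Ω)` (`constraint_of_energy_le`). The quadratic term is continuous on `L^2(Ω)`.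

*Weak compactness.* Lower semicontinuity only needs a point that lies in every closed convex set
containing almost all terms of a bounded sequence. Such a point is obtained from the uniform
convexity of `L^r` by taking near-minimizers of the norm of the gradient over the convex hulls of the
tails (`exists_mem_of_eventually_mem`); the sublevel sets of convex integrals are closed and convex.

*The case `s = 1`.* A function of `W^{1,1}_0(Ω)`, extended by zero, is weakly differentiable on the
whole space. If its gradient is bounded, mollification shows that it is Lipschitz; it vanishes on
`∂Ω` because every ball centred there meets the complement in a set of positive measure. Lipschitz
functions vanishing off `Ω` are limits of test functions with bounded gradients
(`memSobolevZero_top_of_thickComplement`).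

*Minimizers.* The quadratic term improves midpoint convexity to the energy gap
`J_p(u_p) + ‖u_p - v‖ ^ 2 / 2 ≤ J_p(v)` (`IsMinimizer.powerFidelity_add_le`), hence uniqueness. As
`min J_p - |Ω| / p` is nondecreasing and bounded, the gap makes `u_p` a Cauchy family in `L^2(Ω)`,
and by `Γ`-convergence its limit is the minimizer of `J` (`exists_isMinimizer_constraintFidelity`).
The energies of exponent `q` of the `u_p` are bounded, so weak limit points in `W^{1,q}_0(Ω)` exist,
and they are identified by the convergence in `L^2(Ω)`; this is weak convergence
(`weakTendstoSobolevZero_of_energy_le`).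
-/

namespace SobolevGamma

variable {N : ℕ} {Ω K : Set (EuclideanSpace ℝ (Fin N))} {p q : ℝ≥0∞}

/-! ### Weak gradients -/

section WeakGradients

variable {φ ψ v : EuclideanSpace ℝ (Fin N) → ℝ}

lemma continuous_gradient (h : ContDiff ℝ ∞ φ) : Continuous (gradient φ) :=
  (LinearIsometryEquiv.continuous _).comp (h.continuous_fderiv (by simp))

lemma hasCompactSupport_gradient (h : HasCompactSupport φ) :
    HasCompactSupport (gradient φ) :=
  (h.fderiv (𝕜 := ℝ)).comp_left (map_zero _)

lemma IsTest.memLp (h : IsTest Ω φ) (p : ℝ≥0∞) : MemLp φ p (volume.restrict Ω) :=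
  (h.1.continuous.memLp_of_hasCompactSupport h.2.1).restrict Ω

lemma IsTest.memLp_gradient (h : IsTest Ω φ) (p : ℝ≥0∞) :
    MemLp (gradient φ) p (volume.restrict Ω) :=
  ((continuous_gradient h.1).memLp_of_hasCompactSupport
    (hasCompactSupport_gradient h.2.1)).restrict Ω

lemma IsTest.eq_zero_of_notMem (h : IsTest Ω φ) {x : EuclideanSpace ℝ (Fin N)} (hx : x ∉ Ω) :
    φ x = 0 :=
  image_eq_zero_of_notMem_tsupport fun hx' => hx (h.2.2 hx')

lemma IsTest.gradient_eq_zero_of_notMem (h : IsTest Ω φ) {x : EuclideanSpace ℝ (Fin N)}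
    (hx : x ∉ Ω) : gradient φ x = 0 := by
  have : fderiv ℝ φ x = 0 :=
    image_eq_zero_of_notMem_tsupport fun hx' => hx (h.2.2 (tsupport_fderiv_subset ℝ hx'))
  simp [gradient, this]

lemma integral_smul_gradient (hφ : ContDiff ℝ ∞ φ) (hφc : HasCompactSupport φ)
    (hψ : ContDiff ℝ ∞ ψ) (hψc : HasCompactSupport ψ) :
    ∫ x, ψ x • gradient φ x = - ∫ x, φ x • gradient ψ x := by
  have i1 : Integrable fun x => ψ x • gradient φ x :=
    (hψ.continuous.smul (continuous_gradient hφ)).integrable_of_hasCompactSupport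
      hψc.smul_right
  have i2 : Integrable fun x => φ x • gradient ψ x :=
    (hφ.continuous.smul (continuous_gradient hψ)).integrable_of_hasCompactSupport
      hφc.smul_right
  refine ext_inner_left ℝ fun e => ?_
  rw [inner_neg_right, ← integral_inner i1, ← integral_inner i2]
  have hd : ∀ x, inner ℝ e (ψ x • gradient φ x) = ψ x * fderiv ℝ φ x e := fun x => by
    rw [inner_smul_right, inner_gradient_right]; simp
  have hd' : ∀ x, inner ℝ e (φ x • gradient ψ x) = fderiv ℝ ψ x e * φ x := fun x => by
    rw [inner_smul_right, inner_gradient_right]; simp [mul_comm]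
  simp_rw [hd, hd']
  refine integral_mul_fderiv_eq_neg_fderiv_mul_of_integrable ?_ ?_ ?_
    (fun x _ => hψ.differentiable (by simp) x) (fun x _ => hφ.differentiable (by simp) x)
  · simpa [hd'] using i2.const_inner (𝕜 := ℝ) e
  · simpa [hd] using i1.const_inner (𝕜 := ℝ) e
  · exact (hψ.continuous.mul hφ.continuous).integrable_of_hasCompactSupport hψc.mul_right

/-- The Sobolev functions vanishing on the boundary are the limits of the test functions. -/
lemma mem_sobolevZero_iff [Fact (1 ≤ p)] {w : Lp ℝ p (volume.restrict Ω) ×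
    Lp (EuclideanSpace ℝ (Fin N)) p (volume.restrict Ω)} :
    w ∈ sobolevZero Ω p ↔ ∃ φ : ℕ → EuclideanSpace ℝ (Fin N) → ℝ, (∀ n, IsTest Ω (φ n)) ∧
      Tendsto (fun n => eLpNorm (φ n - ⇑w.1) p (volume.restrict Ω)) atTop (𝓝 0) ∧
      Tendsto (fun n => eLpNorm (gradient (φ n) - ⇑w.2) p (volume.restrict Ω)) atTop (𝓝 0) := by
  rw [sobolevZero, ← SetLike.mem_coe, Submodule.topologicalClosure_coe, mem_closure_iff_seq_limit]
  constructor
  · rintro ⟨x, hx, hlim⟩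
    choose φ hφ h1 h2 using hx
    refine ⟨φ, hφ, ?_, ?_⟩
    · have := tendsto_iff_edist_tendsto_0.1 ((continuous_fst.tendsto _).comp hlim)
      refine this.congr fun n => ?_
      rw [Function.comp, Lp.edist_def]
      exact eLpNorm_congr_ae ((h1 n).sub (ae_eq_refl _))
    · have := tendsto_iff_edist_tendsto_0.1 ((continuous_snd.tendsto _).comp hlim)
      refine this.congr fun n => ?_
      rw [Function.comp, Lp.edist_def]
      exact eLpNorm_congr_ae ((h2 n).sub (ae_eq_refl _))
  · rintro ⟨φ, hφ, h1, h2⟩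
    refine ⟨fun n => (((hφ n).memLp p).toLp, ((hφ n).memLp_gradient p).toLp),
      fun n => ⟨φ n, hφ n, ((hφ n).memLp p).coeFn_toLp, ((hφ n).memLp_gradient p).coeFn_toLp⟩, ?_⟩
    rw [← Prod.mk.eta (p := w)]
    refine Tendsto.prodMk_nhds ?_ ?_ <;> rw [tendsto_iff_edist_tendsto_0]
    · refine h1.congr fun n => ?_
      rw [Lp.edist_def]
      exact eLpNorm_congr_ae ((MemLp.coeFn_toLp _).symm.sub (ae_eq_refl _))
    · refine h2.congr fun n => ?_
      rw [Lp.edist_def]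
      exact eLpNorm_congr_ae ((MemLp.coeFn_toLp _).symm.sub (ae_eq_refl _))

lemma tendsto_eLpNorm_of_exponent_le {F : Type*} [NormedAddCommGroup F] {α : Type*}
    [MeasurableSpace α] {μ : Measure α} [IsFiniteMeasure μ] (hpq : p ≤ q)
    {f : ℕ → α → F} (hm : ∀ n, AEStronglyMeasurable (f n) μ)
    (hf : Tendsto (fun n => eLpNorm (f n) q μ) atTop (𝓝 0)) :
    Tendsto (fun n => eLpNorm (f n) p μ) atTop (𝓝 0) := by
  by_cases hp0 : p = 0
  · simp [hp0]
  by_cases hμ : μ = 0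
  · simp [hμ]
  have h := ENNReal.Tendsto.mul_const (b := μ univ ^ (1 / p.toReal - 1 / q.toReal)) hf
    (Or.inr (ENNReal.rpow_ne_top_of_ne_zero (by simpa using hμ) (measure_ne_top _ _)))
  rw [zero_mul] at h
  exact tendsto_of_tendsto_of_tendsto_of_le_of_le tendsto_const_nhds h (fun _ => zero_le)
    fun n => eLpNorm_le_eLpNorm_mul_rpow_measure_univ hpq (hm n)

/-- The weak gradient of a function of `W^{1,p}_0(Ω)` may be tested against functions whose support
is not contained in `Ω`: extension by zero preserves weak differentiability. -/
lemma integral_smul_gradient_of_mem [IsFiniteMeasure (volume.restrict Ω)] [Fact (1 ≤ p)]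
    {w : Lp ℝ p (volume.restrict Ω) × Lp (EuclideanSpace ℝ (Fin N)) p (volume.restrict Ω)}
    (hw : w ∈ sobolevZero Ω p) (hψ : ContDiff ℝ ∞ ψ) (hψc : HasCompactSupport ψ) :
    ∫ x in Ω, w.1 x • gradient ψ x = - ∫ x in Ω, ψ x • w.2 x := by
  obtain ⟨φ, hφ, h1, h2⟩ := mem_sobolevZero_iff.1 hw
  have hp : 1 ≤ p := Fact.out
  obtain ⟨A, hA⟩ := (hasCompactSupport_gradient hψc).exists_bound_of_continuous
    (continuous_gradient hψ)
  obtain ⟨B, hB⟩ := hψc.exists_bound_of_continuous hψ.continuous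
  have t1 : Tendsto (fun n => ∫ x in Ω, φ n x • gradient ψ x) atTop
      (𝓝 (∫ x in Ω, w.1 x • gradient ψ x)) := by
    refine tendsto_integral_of_L1' _ ?_ (.of_forall fun n => ?_) ?_
    · exact (Lp.memLp w.1).1.smul (continuous_gradient hψ).aestronglyMeasurable
    · exact (((hφ n).memLp p).integrable hp).smul_bdd A
        (continuous_gradient hψ).aestronglyMeasurable (.of_forall hA)
    · have := tendsto_eLpNorm_of_exponent_le hp (fun n =>
        ((hφ n).memLp p).1.sub (Lp.memLp w.1).1) h1
      have := ENNReal.Tendsto.const_mul (a := ENNReal.ofReal A) this (Or.inr (by simp))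
      rw [mul_zero] at this
      refine tendsto_of_tendsto_of_tendsto_of_le_of_le tendsto_const_nhds this
        (fun _ => zero_le) fun n => eLpNorm_le_mul_eLpNorm_of_ae_le_mul (.of_forall fun x => ?_) _
      simp only [Pi.sub_apply, ← sub_smul, norm_smul]
      rw [mul_comm]
      gcongr
      exact hA x
  have t2 : Tendsto (fun n => ∫ x in Ω, ψ x • gradient (φ n) x) atTop
      (𝓝 (∫ x in Ω, ψ x • w.2 x)) := by
    refine tendsto_integral_of_L1' _ ?_ (.of_forall fun n => ?_) ?_
    · exact hψ.continuous.aestronglyMeasurable.smul (Lp.memLp w.2).1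
    · exact (((hφ n).memLp_gradient p).integrable hp).bdd_smul B
        hψ.continuous.aestronglyMeasurable (.of_forall hB)
    · have := tendsto_eLpNorm_of_exponent_le hp (fun n =>
        ((hφ n).memLp_gradient p).1.sub (Lp.memLp w.2).1) h2
      have := ENNReal.Tendsto.const_mul (a := ENNReal.ofReal B) this (Or.inr (by simp))
      rw [mul_zero] at this
      refine tendsto_of_tendsto_of_tendsto_of_le_of_le tendsto_const_nhds this
        (fun _ => zero_le) fun n => eLpNorm_le_mul_eLpNorm_of_ae_le_mul (.of_forall fun x => ?_) _
      simp only [Pi.sub_apply, ← smul_sub, norm_smul]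
      gcongr
      exact hB x
  refine tendsto_nhds_unique t1 (t2.neg.congr fun n => ?_)
  rw [setIntegral_eq_integral_of_forall_compl_eq_zero, setIntegral_eq_integral_of_forall_compl_eq_zero,
    integral_smul_gradient hψ hψc (hφ n).1 (hφ n).2.1]
  · intro x hx; simp [(hφ n).eq_zero_of_notMem hx]
  · intro x hx; simp [(hφ n).gradient_eq_zero_of_notMem hx]

lemma hasWeakGradient_of_mem [IsFiniteMeasure (volume.restrict Ω)] [Fact (1 ≤ p)]
    {w : Lp ℝ p (volume.restrict Ω) × Lp (EuclideanSpace ℝ (Fin N)) p (volume.restrict Ω)}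
    (hw : w ∈ sobolevZero Ω p) : HasWeakGradient Ω w.1 w.2 :=
  ⟨IntegrableOn.locallyIntegrableOn ((Lp.memLp w.1).integrable Fact.out),
    IntegrableOn.locallyIntegrableOn ((Lp.memLp w.2).integrable Fact.out),
    fun _ hφ => integral_smul_gradient_of_mem hw hφ.1 hφ.2.1⟩

/-- Weak gradients are unique. -/
lemma HasWeakGradient.ae_eq {v' : EuclideanSpace ℝ (Fin N) → ℝ}
    {g g' : EuclideanSpace ℝ (Fin N) → EuclideanSpace ℝ (Fin N)}
    (hΩ : IsOpen Ω) (hv : v =ᵐ[volume.restrict Ω] v')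
    (h : HasWeakGradient Ω v g) (h' : HasWeakGradient Ω v' g') : g =ᵐ[volume.restrict Ω] g' := by
  have key := hΩ.ae_eq_zero_of_integral_contDiff_smul_eq_zero (h.2.1.sub h'.2.1) (μ := volume)
    fun φ hφ hφc hφΩ => ?_
  · rw [EventuallyEq, ae_restrict_iff' hΩ.measurableSet]
    filter_upwards [key] with x hx hxΩ using sub_eq_zero.1 (hx hxΩ)
  · have hT : IsTest Ω φ := ⟨hφ, hφc, hφΩ⟩
    have e1 := h.2.2 φ hT
    have e2 := h'.2.2 φ hT
    have e3 : ∫ x in Ω, v x • gradient φ x = ∫ x in Ω, v' x • gradient φ x :=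
      integral_congr_ae (by filter_upwards [hv] with x hx using by rw [hx])
    have i (f : EuclideanSpace ℝ (Fin N) → EuclideanSpace ℝ (Fin N))
        (hf : LocallyIntegrableOn f Ω) : Integrable (fun x => φ x • f x) (volume.restrict Ω) := by
      have hf' := hf.integrableOn_compact_subset hφΩ hφc
      obtain ⟨B, hB⟩ := hφc.exists_bound_of_continuous hφ.continuous
      have : IntegrableOn (fun x => φ x • f x) (tsupport φ) :=
        hf'.bdd_smul B hφ.continuous.aestronglyMeasurable (.of_forall hB)
      rw [integrableOn_iff_integrable_of_support_subset] at this
      · exact this.integrableOn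
      · exact (Function.support_smul_subset_left φ f).trans (subset_tsupport φ)
    rw [← setIntegral_eq_integral_of_forall_compl_eq_zero (s := Ω)]
    · simp only [Pi.sub_apply, smul_sub]
      rw [integral_sub (i _ h.2.1) (i _ h'.2.1), sub_eq_zero]
      exact neg_injective (by rw [← e1, ← e2, e3])
    · intro x hx; simp [hT.eq_zero_of_notMem hx]

lemma HasWeakGradient.congr_ae {v' : EuclideanSpace ℝ (Fin N) → ℝ}
    {g : EuclideanSpace ℝ (Fin N) → EuclideanSpace ℝ (Fin N)}
    (h : HasWeakGradient Ω v g) (hΩ : IsOpen Ω) (hv : v =ᵐ[volume.restrict Ω] v') :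
    HasWeakGradient Ω v' g := by
  refine ⟨?_, h.2.1, fun φ hφ => ?_⟩
  · rw [locallyIntegrableOn_iff hΩ.isLocallyClosed]
    intro k hk hkc
    exact ((locallyIntegrableOn_iff hΩ.isLocallyClosed).1 h.1 k hk hkc).congr_fun_ae
      (ae_restrict_of_ae_restrict_of_subset hk hv)
  · rw [← h.2.2 φ hφ]
    exact integral_congr_ae (by filter_upwards [hv] with x hx using by rw [hx])

lemma HasWeakGradient.weakGradient_ae_eq
    {g : EuclideanSpace ℝ (Fin N) → EuclideanSpace ℝ (Fin N)}
    (h : HasWeakGradient Ω v g) (hΩ : IsOpen Ω) : weakGradient Ω v =ᵐ[volume.restrict Ω] g := by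
  have hex : ∃ g, HasWeakGradient Ω v g := ⟨g, h⟩
  rw [weakGradient, dif_pos hex]
  exact hex.choose_spec.ae_eq hΩ (ae_eq_refl _) h

lemma memSobolevZeroFin_of_tendsto (hp : 1 ≤ p)
    {φ : ℕ → EuclideanSpace ℝ (Fin N) → ℝ} (hφ : ∀ n, IsTest Ω (φ n))
    {g : EuclideanSpace ℝ (Fin N) → EuclideanSpace ℝ (Fin N)}
    (hv : MemLp v p (volume.restrict Ω)) (hg : MemLp g p (volume.restrict Ω))
    (h1 : Tendsto (fun n => eLpNorm (φ n - v) p (volume.restrict Ω)) atTop (𝓝 0))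
    (h2 : Tendsto (fun n => eLpNorm (gradient (φ n) - g) p (volume.restrict Ω)) atTop (𝓝 0)) :
    MemSobolevZeroFin Ω p v := by
  have : Fact (1 ≤ p) := ⟨hp⟩
  refine ⟨this, ⟨(hv.toLp v, hg.toLp g), mem_sobolevZero_iff.2 ⟨φ, hφ, ?_, ?_⟩⟩, hv.coeFn_toLp⟩
  · exact h1.congr fun n => eLpNorm_congr_ae ((ae_eq_refl _).sub hv.coeFn_toLp.symm)
  · exact h2.congr fun n => eLpNorm_congr_ae ((ae_eq_refl _).sub hg.coeFn_toLp.symm)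

lemma MemSobolevZeroFin.congr_ae {v' : EuclideanSpace ℝ (Fin N) → ℝ}
    (h : MemSobolevZeroFin Ω p v) (hv : v =ᵐ[volume.restrict Ω] v') : MemSobolevZeroFin Ω p v' := by
  obtain ⟨hp, w, hw⟩ := h
  exact ⟨hp, w, hw.trans hv⟩

lemma IsTest.memSobolevZeroFin (h : IsTest Ω φ) (hp : 1 ≤ p) : MemSobolevZeroFin Ω p φ :=
  memSobolevZeroFin_of_tendsto hp (fun _ => h) (h.memLp p) (h.memLp_gradient p)
    (by simp) (by simp)

variable [IsFiniteMeasure (volume.restrict Ω)]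

lemma weakGradient_ae_eq_of_mem [Fact (1 ≤ p)] (hΩ : IsOpen Ω)
    {w : Lp ℝ p (volume.restrict Ω) × Lp (EuclideanSpace ℝ (Fin N)) p (volume.restrict Ω)}
    (hw : w ∈ sobolevZero Ω p) (hv : w.1 =ᵐ[volume.restrict Ω] v) :
    weakGradient Ω v =ᵐ[volume.restrict Ω] w.2 :=
  ((hasWeakGradient_of_mem hw).congr_ae hΩ hv).weakGradient_ae_eq hΩ

/-- A function of `W^{1,p}_0(Ω)` determines its gradient. -/
lemma sobolevZero_ext [Fact (1 ≤ p)] (hΩ : IsOpen Ω) {w w' : sobolevZero Ω p}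
    (h : w.1.1 = w'.1.1) : w = w' := by
  refine Subtype.ext (Prod.ext h (Lp.ext ?_))
  exact (hasWeakGradient_of_mem w.2).ae_eq hΩ (by rw [h]) (hasWeakGradient_of_mem w'.2)

lemma MemSobolevZeroFin.of_exponent_le (hp : 1 ≤ p) (hpq : p ≤ q)
    (h : MemSobolevZeroFin Ω q v) : MemSobolevZeroFin Ω p v := by
  obtain ⟨hq, w, hw⟩ := h
  obtain ⟨φ, hφ, h1, h2⟩ := mem_sobolevZero_iff.1 w.2
  refine memSobolevZeroFin_of_tendsto hp hφ (((Lp.memLp w.1.1).mono_exponent hpq).ae_eq hw)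
    ((Lp.memLp w.1.2).mono_exponent hpq) ?_ ?_
  · refine (tendsto_eLpNorm_of_exponent_le hpq (fun n =>
      ((hφ n).memLp p).1.sub (Lp.memLp w.1.1).1) h1).congr fun n => eLpNorm_congr_ae ?_
    exact (ae_eq_refl _).sub hw
  · exact tendsto_eLpNorm_of_exponent_le hpq (fun n =>
      ((hφ n).memLp_gradient p).1.sub (Lp.memLp w.1.2).1) h2

end WeakGradients

end SobolevGamma

namespace SobolevGamma

variable {N : ℕ} {Ω K : Set (EuclideanSpace ℝ (Fin N))} {p q : ℝ≥0∞}

/-! ### Poincaré inequality -/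

section Poincare

variable {φ v : EuclideanSpace ℝ (Fin N) → ℝ} {r D : ℝ} {e : EuclideanSpace ℝ (Fin N)}

lemma lintegral_rpow_le {α : Type*} [MeasurableSpace α] {μ : Measure α} {f : α → ℝ≥0∞}
    (hf : AEMeasurable f μ) (hr : 1 ≤ r) :
    (∫⁻ x, f x ∂μ) ^ r ≤ μ univ ^ (r - 1) * ∫⁻ x, f x ^ r ∂μ := by
  have hr0 : 0 < r := by linarith
  have h := eLpNorm_le_eLpNorm_mul_rpow_measure_univ (p := 1) (q := ENNReal.ofReal r)
    (by simpa using hr) hf.aestronglyMeasurable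
  rw [eLpNorm_one_eq_lintegral_enorm, eLpNorm_eq_lintegral_rpow_enorm_toReal (by simpa using hr0)
    (by simp), ENNReal.toReal_ofReal hr0.le] at h
  simp only [enorm_eq_self] at h
  refine (ENNReal.rpow_le_rpow h hr0.le).trans_eq ?_
  rw [ENNReal.mul_rpow_of_nonneg _ _ hr0.le, ← ENNReal.rpow_mul, ← ENNReal.rpow_mul, mul_comm]
  congr 2
  · simp only [ENNReal.toReal_one]; field_simp
  · simp [hr0.ne']

/-- Integration along the segment from `x` to a point at which `φ` vanishes. -/
lemma enorm_rpow_le_lintegral_gradient (hφ : ContDiff ℝ ∞ φ) (he : ‖e‖ = 1) (hD : 0 ≤ D)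
    (hr : 1 ≤ r) {x : EuclideanSpace ℝ (Fin N)} (hx : φ (x + D • e) = 0) :
    ‖φ x‖ₑ ^ r ≤ ENNReal.ofReal D ^ (r - 1) *
      ∫⁻ t in Ioc 0 D, ‖gradient φ (x + t • e)‖ₑ ^ r := by
  have hcont : Continuous fun t : ℝ => gradient φ (x + t • e) :=
    (continuous_gradient hφ).comp (by fun_prop)
  have hder : ∀ t : ℝ, HasDerivAt (fun t => φ (x + t • e))
      (inner ℝ (gradient φ (x + t • e)) e) t := fun t => by
    have h1 : HasDerivAt (fun t : ℝ => x + t • e) e t := by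
      simpa using ((hasDerivAt_id t).smul_const e).const_add x
    have h2 := (hφ.differentiable (by simp) (x + t • e)).hasFDerivAt.comp_hasDerivAt t h1
    rwa [← inner_gradient_left] at h2
  have hint := intervalIntegral.integral_eq_sub_of_hasDerivAt (a := 0) (b := D)
    (fun t _ => hder t) ((hcont.inner continuous_const).intervalIntegrable _ _)
  rw [hx, zero_smul, add_zero, zero_sub, intervalIntegral.integral_of_le hD] at hint
  have h1 : ‖φ x‖ₑ ≤ ∫⁻ t in Ioc 0 D, ‖gradient φ (x + t • e)‖ₑ := by
    rw [← enorm_neg, ← hint]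
    refine (enorm_integral_le_lintegral_enorm _).trans (lintegral_mono fun t => ?_)
    rw [enorm_le_iff_norm_le]
    simpa [he] using norm_inner_le_norm (𝕜 := ℝ) (gradient φ (x + t • e)) e
  refine (ENNReal.rpow_le_rpow h1 (by linarith)).trans ?_
  simpa using lintegral_rpow_le (μ := volume.restrict (Ioc 0 D))
    hcont.enorm.measurable.aemeasurable hr

/-- Poincaré's inequality, with a constant that does not depend on the exponent. -/
lemma IsTest.lintegral_rpow_le_gradient (h : IsTest Ω φ) (hΩ : MeasurableSet Ω) (he : ‖e‖ = 1)
    (hD : 0 < D) (hΩD : ∀ x ∈ Ω, ∀ y ∈ Ω, dist x y < D) (hr : 1 ≤ r) :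
    ∫⁻ x in Ω, ‖φ x‖ₑ ^ r ≤ ENNReal.ofReal D ^ r * ∫⁻ x in Ω, ‖gradient φ x‖ₑ ^ r := by
  have hr0 : 0 < r := by linarith
  have hgc := continuous_gradient h.1
  calc ∫⁻ x in Ω, ‖φ x‖ₑ ^ r
      ≤ ∫⁻ x in Ω, ENNReal.ofReal D ^ (r - 1) *
          ∫⁻ t in Ioc 0 D, ‖gradient φ (x + t • e)‖ₑ ^ r := by
        refine setLIntegral_mono' hΩ fun x hx => ?_
        refine enorm_rpow_le_lintegral_gradient h.1 he hD.le hr (h.eq_zero_of_notMem fun hx' => ?_)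
        have := hΩD _ hx' _ hx
        simp [norm_smul, he, abs_of_pos hD] at this
    _ ≤ ∫⁻ x, ENNReal.ofReal D ^ (r - 1) *
          ∫⁻ t in Ioc 0 D, ‖gradient φ (x + t • e)‖ₑ ^ r := setLIntegral_le_lintegral _ _
    _ = ENNReal.ofReal D ^ (r - 1) *
          ∫⁻ t in Ioc 0 D, ∫⁻ x, ‖gradient φ (x + t • e)‖ₑ ^ r := by
        rw [lintegral_const_mul' _ _ (ENNReal.rpow_ne_top_of_nonneg (by linarith) (by simp)),
          lintegral_lintegral_swap]
        refine Measurable.aemeasurable ?_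
        refine Measurable.pow_const (Continuous.measurable ?_) r
        exact (hgc.comp (by fun_prop)).enorm
    _ = ENNReal.ofReal D ^ (r - 1) * (ENNReal.ofReal D * ∫⁻ x, ‖gradient φ x‖ₑ ^ r) := by
        congr 1
        simp_rw [lintegral_add_right_eq_self (fun x => ‖gradient φ x‖ₑ ^ r)]
        simp [mul_comm]
    _ = ENNReal.ofReal D ^ r * ∫⁻ x in Ω, ‖gradient φ x‖ₑ ^ r := by
        rw [← mul_assoc, setLIntegral_eq_of_support_subset]
        · congr 1
          conv_lhs => rw [← ENNReal.rpow_one (ENNReal.ofReal D), ← ENNReal.rpow_mul]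
          rw [← ENNReal.rpow_add _ _ (by simpa using hD) (by simp)]
          congr 1; ring
        · intro x hx
          by_contra hx'
          simp [h.gradient_eq_zero_of_notMem hx', hr0] at hx

end Poincare
end SobolevGamma

namespace SobolevGamma

/-! ### Weak limit points without weak topologies -/

section Mazur

/-- A substitute for weak sequential compactness. If `‖T x‖` is an equivalent norm on `X` which is
uniformly convex (in the form `hUC`), then a bounded sequence has a weak limit point: a point lying
in every closed convex set that contains all but finitely many terms. It is the limit of
near-minimizers `y n` of `‖T y‖ ^ r` over the convex hulls of the tails of the sequence; the minimal
values increase to a limit, so by uniform convexity `y` is a Cauchy sequence. -/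
lemma exists_mem_of_eventually_mem {X Y : Type*} [NormedAddCommGroup X] [NormedSpace ℝ X]
    [CompleteSpace X] [NormedAddCommGroup Y] [NormedSpace ℝ Y] (T : X →ₗ[ℝ] Y) {D r : ℝ}
    (hD : 0 < D) (hT : ∀ x, ‖x‖ ≤ D * ‖T x‖) (hr : 0 < r)
    (hUC : ∀ ε > 0, ∃ A ≥ (0 : ℝ), ∀ f g : Y, ‖f - g‖ ^ r ≤ ε * (‖f‖ ^ r + ‖g‖ ^ r) +
      A * ((‖f‖ ^ r + ‖g‖ ^ r) / 2 - ‖(1 / 2 : ℝ) • (f + g)‖ ^ r))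
    {x : ℕ → X} {M : ℝ} (hM : ∀ n, ‖T (x n)‖ ≤ M) :
    ∃ y, ∀ C : Set X, Convex ℝ C → IsClosed C → (∀ᶠ n in atTop, x n ∈ C) → y ∈ C := by
  set S : ℕ → Set X := fun n => convexHull ℝ (x '' Ici n) with hS
  have hSanti : Antitone S := fun m n hmn =>
    convexHull_mono (image_mono (Ici_subset_Ici.2 hmn))
  have hxS : ∀ n, x n ∈ S n := fun n => subset_convexHull ℝ _ ⟨n, self_mem_Ici, rfl⟩
  set b : ℕ → ℝ := fun n => sInf ((fun z => ‖T z‖ ^ r) '' S n) with hb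
  have hbdd : ∀ n, BddBelow ((fun z => ‖T z‖ ^ r) '' S n) := fun n =>
    ⟨0, by rintro _ ⟨z, -, rfl⟩; positivity⟩
  have hble : ∀ n, ∀ z ∈ S n, b n ≤ ‖T z‖ ^ r := fun n z hz =>
    csInf_le (hbdd n) (mem_image_of_mem _ hz)
  have hbmono : Monotone b := fun m n hmn =>
    csInf_le_csInf (hbdd m) (Set.Nonempty.image _ ⟨_, hxS n⟩) (image_mono (hSanti hmn))
  have hbM : ∀ n, b n ≤ M ^ r := fun n => (hble n _ (hxS n)).trans
    (Real.rpow_le_rpow (norm_nonneg _) (hM n) hr.le)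
  obtain ⟨B, hB⟩ : ∃ B, Tendsto b atTop (𝓝 B) :=
    ⟨_, tendsto_atTop_ciSup hbmono ⟨_, by rintro _ ⟨n, rfl⟩; exact hbM n⟩⟩
  have hbB : ∀ n, b n ≤ B := hbmono.ge_of_tendsto hB
  have hex : ∀ n : ℕ, ∃ y ∈ S n, ‖T y‖ ^ r < b n + 1 / ((n : ℝ) + 1) := fun n => by
    obtain ⟨_, ⟨y, hy, rfl⟩, h⟩ := exists_lt_of_csInf_lt
      (Set.Nonempty.image (fun z => ‖T z‖ ^ r) ⟨_, hxS n⟩)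
      (show sInf ((fun z => ‖T z‖ ^ r) '' S n) < b n + 1 / ((n : ℝ) + 1) from
        lt_add_of_pos_right _ (by positivity))
    exact ⟨y, hy, h⟩
  choose y hyS hy using hex
  have hcau : CauchySeq y := by
    refine Metric.cauchySeq_iff'.2 fun η hη => ?_
    set R : ℝ := |B| + 1 with hR
    have hRpos : 0 < R := by positivity
    have hyR : ∀ n, ‖T (y n)‖ ^ r ≤ R := fun n => by
      have h1 : 1 / ((n : ℝ) + 1) ≤ 1 := by
        rw [div_le_one (by positivity)]; linarith [n.cast_nonneg (α := ℝ)]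
      linarith [hy n, hbB n, le_abs_self B]
    have hη' : 0 < (η / D) ^ r := by positivity
    obtain ⟨A, hA0, hA⟩ := hUC ((η / D) ^ r / (4 * R)) (by positivity)
    have hlim : Tendsto (fun n : ℕ => A * ((B - b n) / 2 + 1 / ((n : ℝ) + 1))) atTop (𝓝 0) := by
      have := (((tendsto_const_nhds (x := B)).sub hB).div_const 2).add
        tendsto_one_div_add_atTop_nhds_zero_nat
      simpa using this.const_mul A
    obtain ⟨n, hn⟩ := (hlim.eventually_lt_const (half_pos hη')).exists
    refine ⟨n, fun m hm => ?_⟩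
    -- the midpoint competes with the near-minimizers on the `n`-th tail
    have hz : (1 / 2 : ℝ) • (y m + y n) ∈ S n := by
      rw [smul_add]
      exact convex_convexHull ℝ _ (hSanti hm (hyS m)) (hyS n) (by norm_num) (by norm_num)
        (by norm_num)
    have h1 := hble n _ hz
    rw [map_smul, map_add] at h1
    have h2 : 1 / ((m : ℝ) + 1) ≤ 1 / ((n : ℝ) + 1) := by
      have : (n : ℝ) ≤ m := by exact_mod_cast hm
      gcongr
    have h3 : A * ((‖T (y m)‖ ^ r + ‖T (y n)‖ ^ r) / 2 - ‖(1 / 2 : ℝ) • (T (y m) + T (y n))‖ ^ r)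
        ≤ A * ((B - b n) / 2 + 1 / ((n : ℝ) + 1)) := by
      gcongr
      linarith [hy m, hy n, hbB m]
    have h4 : (η / D) ^ r / (4 * R) * (‖T (y m)‖ ^ r + ‖T (y n)‖ ^ r) ≤ (η / D) ^ r / 2 := by
      calc _ ≤ (η / D) ^ r / (4 * R) * (R + R) := by
            gcongr
            exacts [hyR m, hyR n]
        _ = _ := by field_simp; ring
    have h5 : ‖T (y m) - T (y n)‖ ^ r < (η / D) ^ r := by linarith [hA (T (y m)) (T (y n))]
    have h6 := (Real.rpow_lt_rpow_iff (norm_nonneg _) (by positivity) hr).1 h5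
    rw [dist_eq_norm]
    calc ‖y m - y n‖ ≤ D * ‖T (y m - y n)‖ := hT _
      _ < D * (η / D) := by rw [map_sub]; gcongr
      _ = η := by field_simp
  obtain ⟨z, hz⟩ := cauchySeq_tendsto_of_complete hcau
  refine ⟨z, fun C hC hCc hxC => ?_⟩
  obtain ⟨n, hn⟩ := eventually_atTop.1 hxC
  refine hCc.mem_of_tendsto hz (eventually_atTop.2 ⟨n, fun m hm => ?_⟩)
  refine convexHull_min ?_ hC (hyS m)
  rintro _ ⟨k, hk, rfl⟩
  exact hn k (hm.trans hk)

/-- A quantitative form of the strict convexity of `‖·‖ ^ r`; by homogeneity it is enough to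
compare both sides on a compact set. -/
lemma exists_norm_sub_rpow_le {F : Type*} [NormedAddCommGroup F] [InnerProductSpace ℝ F]
    [FiniteDimensional ℝ F] {r : ℝ} (hr : 1 < r) {ε : ℝ} (hε : 0 < ε) :
    ∃ A ≥ (0 : ℝ), ∀ a b : F, ‖a - b‖ ^ r ≤ ε * (‖a‖ ^ r + ‖b‖ ^ r) +
      A * ((‖a‖ ^ r + ‖b‖ ^ r) / 2 - ‖(1 / 2 : ℝ) • (a + b)‖ ^ r) := by
  have hr0 : 0 < r := by linarith
  have hmid : ∀ a b : F, ‖(1 / 2 : ℝ) • (a + b)‖ ≤ (1 / 2) * ‖a‖ + (1 / 2) * ‖b‖ := fun a b => by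
    rw [norm_smul, ← mul_add, Real.norm_of_nonneg (by norm_num)]
    gcongr
    exact norm_add_le a b
  have hconv : ∀ a b : F, (1 / 2 * ‖a‖ + 1 / 2 * ‖b‖) ^ r ≤ (‖a‖ ^ r + ‖b‖ ^ r) / 2 := fun a b => by
    have := (convexOn_rpow hr.le).2 (mem_Ici.2 (norm_nonneg a)) (mem_Ici.2 (norm_nonneg b))
      (by norm_num : (0 : ℝ) ≤ 1 / 2) (by norm_num : (0 : ℝ) ≤ 1 / 2) (by norm_num)
    simp only [smul_eq_mul] at this
    linarith
  have hnn : ∀ a b : F, 0 ≤ (‖a‖ ^ r + ‖b‖ ^ r) / 2 - ‖(1 / 2 : ℝ) • (a + b)‖ ^ r := fun a b =>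
    sub_nonneg.2 ((Real.rpow_le_rpow (norm_nonneg _) (hmid a b) hr0.le).trans (hconv a b))
  have hpos : ∀ a b : F, a ≠ b →
      0 < (‖a‖ ^ r + ‖b‖ ^ r) / 2 - ‖(1 / 2 : ℝ) • (a + b)‖ ^ r := fun a b hab => by
    rcases eq_or_ne ‖a‖ ‖b‖ with h | h
    · have h1 : ‖(1 / 2 : ℝ) • (a + b)‖ < ‖a‖ := by
        have := (norm_add_lt_of_not_sameRay (x := a) (y := b)
          fun hs => hab ((sameRay_iff_of_norm_eq h).1 hs))
        rw [norm_smul, Real.norm_of_nonneg (by norm_num)]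
        linarith
      have h2 := Real.rpow_lt_rpow (norm_nonneg _) h1 hr0
      rw [← h]
      linarith
    · have := (strictConvexOn_rpow hr).2 (mem_Ici.2 (norm_nonneg a)) (mem_Ici.2 (norm_nonneg b)) h
        (by norm_num : (0 : ℝ) < 1 / 2) (by norm_num : (0 : ℝ) < 1 / 2) (by norm_num)
      simp only [smul_eq_mul] at this
      have := Real.rpow_le_rpow (norm_nonneg _) (hmid a b) hr0.le
      linarith
  have hcr : Continuous fun t : ℝ => t ^ r := Real.continuous_rpow_const hr0.le
  set Δ : F × F → ℝ := fun z =>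
    (‖z.1‖ ^ r + ‖z.2‖ ^ r) / 2 - ‖(1 / 2 : ℝ) • (z.1 + z.2)‖ ^ r with hΔ
  have hΔc : Continuous Δ := by
    have h1 := hcr.comp (continuous_norm.comp (continuous_fst (X := F) (Y := F)))
    have h2 := hcr.comp (continuous_norm.comp (continuous_snd (X := F) (Y := F)))
    have h3 : Continuous fun z : F × F => ‖(1 / 2 : ℝ) • (z.1 + z.2)‖ := by fun_prop
    exact ((h1.add h2).div_const 2).sub (hcr.comp h3)
  set S : Set (F × F) := {z | ‖z.1‖ ^ r + ‖z.2‖ ^ r = 1 ∧ ε ≤ ‖z.1 - z.2‖ ^ r} with hS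
  have hle1 : ∀ z ∈ S, ‖z.1‖ ≤ 1 ∧ ‖z.2‖ ≤ 1 := fun z hz => by
    have h1 : 0 ≤ ‖z.1‖ ^ r := by positivity
    have h2 : 0 ≤ ‖z.2‖ ^ r := by positivity
    constructor <;> rw [← Real.rpow_le_rpow_iff (norm_nonneg _) zero_le_one hr0, Real.one_rpow] <;>
      linarith [hz.1]
  have hSc : IsCompact S := by
    refine Metric.isCompact_of_isClosed_isBounded ?_ ?_
    · have h1 := hcr.comp (continuous_norm.comp (continuous_fst (X := F) (Y := F)))
      have h2 := hcr.comp (continuous_norm.comp (continuous_snd (X := F) (Y := F)))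
      have h3 : Continuous fun z : F × F => ‖z.1 - z.2‖ := by fun_prop
      exact (isClosed_eq (h1.add h2) continuous_const).inter
        (isClosed_le continuous_const (hcr.comp h3))
    · refine (Metric.isBounded_closedBall (x := (0 : F × F)) (r := 1)).subset fun z hz => ?_
      rw [mem_closedBall_zero_iff, Prod.norm_def]
      exact max_le (hle1 z hz).1 (hle1 z hz).2
  obtain ⟨δ, hδ, hδS⟩ : ∃ δ > 0, ∀ z ∈ S, δ ≤ Δ z := by
    rcases S.eq_empty_or_nonempty with h | h
    · exact ⟨1, one_pos, by simp [h]⟩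
    · obtain ⟨z, hz, hmin⟩ := hSc.exists_isMinOn h hΔc.continuousOn
      refine ⟨Δ z, hpos _ _ fun hab => ?_, fun z' hz' => hmin hz'⟩
      have := hz.2
      rw [hab, sub_self, norm_zero, Real.zero_rpow hr0.ne'] at this
      linarith
  refine ⟨2 ^ r / δ, by positivity, fun a b => ?_⟩
  by_cases hcase : ‖a - b‖ ^ r ≤ ε * (‖a‖ ^ r + ‖b‖ ^ r)
  · have := mul_nonneg (show 0 ≤ 2 ^ r / δ by positivity) (hnn a b)
    linarith
  set s := ‖a‖ ^ r + ‖b‖ ^ r with hs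
  have hs0 : 0 ≤ s := by positivity
  have hspos : 0 < s := by
    refine hs0.lt_of_ne fun h => hcase ?_
    have h1 : 0 ≤ ‖a‖ ^ r := by positivity
    have h2 : 0 ≤ ‖b‖ ^ r := by positivity
    have ha : a = 0 := by
      have : ‖a‖ ^ r = 0 := by linarith
      simpa [Real.rpow_eq_zero (norm_nonneg a) hr0.ne'] using this
    have hb : b = 0 := by
      have : ‖b‖ ^ r = 0 := by linarith
      simpa [Real.rpow_eq_zero (norm_nonneg b) hr0.ne'] using this
    rw [ha, hb, sub_zero, norm_zero, Real.zero_rpow hr0.ne', ← h, mul_zero]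
  -- rescaling `(a, b)` to the unit sphere of the norm `(‖a‖ ^ r + ‖b‖ ^ r) ^ (1 / r)`
  set l : ℝ := s ^ (-(1 / r)) with hl
  have hlpos : 0 < l := by positivity
  have hlr : l ^ r = s⁻¹ := by
    rw [hl, ← Real.rpow_mul hs0, ← Real.rpow_neg_one]
    congr 1; field_simp
  have hscale : ∀ c : F, ‖l • c‖ ^ r = s⁻¹ * ‖c‖ ^ r := fun c => by
    rw [norm_smul, Real.norm_of_nonneg hlpos.le, Real.mul_rpow hlpos.le (norm_nonneg _), hlr]
  have hmem : (l • a, l • b) ∈ S := by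
    constructor
    · change ‖l • a‖ ^ r + ‖l • b‖ ^ r = 1
      rw [hscale, hscale, ← mul_add, ← hs, inv_mul_cancel₀ hspos.ne']
    · change ε ≤ ‖l • a - l • b‖ ^ r
      rw [← smul_sub, hscale, le_inv_mul_iff₀ hspos, mul_comm]
      exact (not_le.1 hcase).le
  have h1 := hδS _ hmem
  have h2 : Δ (l • a, l • b) = s⁻¹ * (s / 2 - ‖(1 / 2 : ℝ) • (a + b)‖ ^ r) := by
    simp only [hΔ]
    rw [← smul_add, smul_comm, hscale, hscale, hscale, hs]; ring
  have h3 : ‖l • a - l • b‖ ^ r ≤ 2 ^ r := by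
    refine Real.rpow_le_rpow (norm_nonneg _) ((norm_sub_le _ _).trans ?_) hr0.le
    linarith [(hle1 _ hmem).1, (hle1 _ hmem).2]
  rw [← smul_sub, hscale, inv_mul_le_iff₀ hspos] at h3
  rw [h2, le_inv_mul_iff₀ hspos] at h1
  have h4 : 0 ≤ ε * s := by positivity
  have h5 : s * 2 ^ r ≤ 2 ^ r / δ * (s / 2 - ‖(1 / 2 : ℝ) • (a + b)‖ ^ r) := by
    rw [div_mul_eq_mul_div, le_div_iff₀ hδ]
    have : (0 : ℝ) < 2 ^ r := by positivity
    nlinarith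
  linarith

lemma norm_rpow_eq_integral {α F : Type*} [MeasurableSpace α] {μ : Measure α}
    [NormedAddCommGroup F] {r : ℝ} (hr : 0 < r) (f : Lp F (ENNReal.ofReal r) μ) :
    ‖f‖ ^ r = ∫ x, ‖f x‖ ^ r ∂μ := by
  have h := (Lp.memLp f).eLpNorm_eq_integral_rpow_norm (by simpa using hr) (by simp)
  rw [Lp.norm_def, h, ENNReal.toReal_ofReal hr.le, ENNReal.toReal_ofReal (by positivity),
    ← Real.rpow_mul (integral_nonneg fun x => by positivity), inv_mul_cancel₀ hr.ne',
    Real.rpow_one]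

lemma integrable_norm_rpow_coeFn {α F : Type*} [MeasurableSpace α] {μ : Measure α}
    [NormedAddCommGroup F] {r : ℝ} (hr : 0 < r) (f : Lp F (ENNReal.ofReal r) μ) :
    Integrable (fun x => ‖f x‖ ^ r) μ := by
  simpa [ENNReal.toReal_ofReal hr.le] using
    (Lp.memLp f).integrable_norm_rpow (by simpa using hr) (by simp)

/-- Uniform convexity of `L^r`, by integration of the pointwise inequality. -/
lemma exists_Lp_norm_sub_rpow_le {α F : Type*} [MeasurableSpace α] {μ : Measure α}
    [NormedAddCommGroup F] [InnerProductSpace ℝ F] [FiniteDimensional ℝ F] {r : ℝ} (hr : 1 < r)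
    {ε : ℝ} (hε : 0 < ε) :
    ∃ A ≥ (0 : ℝ), ∀ f g : Lp F (ENNReal.ofReal r) μ, ‖f - g‖ ^ r ≤ ε * (‖f‖ ^ r + ‖g‖ ^ r) +
      A * ((‖f‖ ^ r + ‖g‖ ^ r) / 2 - ‖(1 / 2 : ℝ) • (f + g)‖ ^ r) := by
  obtain ⟨A, hA0, hA⟩ := exists_norm_sub_rpow_le (F := F) hr hε
  have hr0 : 0 < r := by linarith
  refine ⟨A, hA0, fun f g => ?_⟩
  simp only [norm_rpow_eq_integral hr0]
  have i1 := integrable_norm_rpow_coeFn hr0 f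
  have i2 := integrable_norm_rpow_coeFn hr0 g
  have i3 := integrable_norm_rpow_coeFn hr0 ((1 / 2 : ℝ) • (f + g))
  have i12 : Integrable (fun x => ‖f x‖ ^ r + ‖g x‖ ^ r) μ := i1.add i2
  have i4 : Integrable (fun x => A * ((‖f x‖ ^ r + ‖g x‖ ^ r) / 2 -
      ‖((1 / 2 : ℝ) • (f + g) : Lp F (ENNReal.ofReal r) μ) x‖ ^ r)) μ :=
    ((i12.div_const 2).sub i3).const_mul A
  rw [← integral_add i1 i2, ← integral_div, ← integral_sub (i12.div_const 2) i3,
    ← integral_const_mul, ← integral_const_mul, ← integral_add (i12.const_mul ε) i4]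
  refine integral_mono_ae (integrable_norm_rpow_coeFn hr0 _) ((i12.const_mul ε).add i4) ?_
  filter_upwards [Lp.coeFn_sub f g, Lp.coeFn_smul (1 / 2 : ℝ) (f + g), Lp.coeFn_add f g]
    with x h1 h2 h3
  simp only [h1, h2, h3, Pi.sub_apply, Pi.smul_apply, Pi.add_apply]
  exact hA _ _

end Mazur
end SobolevGamma

namespace SobolevGamma

variable {N : ℕ} {Ω K : Set (EuclideanSpace ℝ (Fin N))} {p q : ℝ≥0∞}

/-! ### Convex integral functionals on the Sobolev spaces -/

section Energies

variable {v : EuclideanSpace ℝ (Fin N) → ℝ} {r : ℝ}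
  {ℓ : EuclideanSpace ℝ (Fin N) → ℝ → ℝ}

/-- Poincaré's inequality on `W^{1,r}_0(Ω)`, with one constant for all exponents. -/
lemma exists_norm_fst_le (hN : 0 < N) (hΩ : MeasurableSet Ω) (hΩb : Bornology.IsBounded Ω) :
    ∃ D > 0, ∀ r : ℝ, 1 ≤ r → ∀ [Fact (1 ≤ ENNReal.ofReal r)],
      ∀ w : sobolevZero Ω (ENNReal.ofReal r), ‖w.1.1‖ ≤ D * ‖w.1.2‖ := by
  obtain ⟨C, hC⟩ := Metric.isBounded_iff.1 hΩb
  refine ⟨|C| + 1, by positivity, fun r hr _ w => ?_⟩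
  have hr0 : 0 < r := by linarith
  have hcl : IsClosed {w : Lp ℝ (ENNReal.ofReal r) (volume.restrict Ω) ×
      Lp (EuclideanSpace ℝ (Fin N)) (ENNReal.ofReal r) (volume.restrict Ω) |
      ‖w.1‖ ≤ (|C| + 1) * ‖w.2‖} :=
    isClosed_le (by fun_prop) (by fun_prop)
  refine closure_minimal ?_ hcl w.2
  rintro w ⟨φ, hφ, h1, h2⟩
  have hP := hφ.lintegral_rpow_le_gradient hΩ (e := EuclideanSpace.single ⟨0, hN⟩ (1 : ℝ))
    (D := |C| + 1) (by simp) (by positivity)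
    (fun x hx y hy => by linarith [hC hx hy, le_abs_self C]) hr
  have hP' : eLpNorm φ (ENNReal.ofReal r) (volume.restrict Ω) ≤
      ENNReal.ofReal (|C| + 1) * eLpNorm (gradient φ) (ENNReal.ofReal r) (volume.restrict Ω) := by
    rw [eLpNorm_eq_lintegral_rpow_enorm_toReal (by simpa using hr0) (by simp),
      eLpNorm_eq_lintegral_rpow_enorm_toReal (by simpa using hr0) (by simp),
      ENNReal.toReal_ofReal hr0.le]
    refine (ENNReal.rpow_le_rpow hP (by positivity)).trans_eq ?_
    rw [ENNReal.mul_rpow_of_nonneg _ _ (by positivity), ← ENNReal.rpow_mul,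
      mul_one_div_cancel hr0.ne', ENNReal.rpow_one]
  change ‖w.1‖ ≤ (|C| + 1) * ‖w.2‖
  rw [Lp.norm_def, Lp.norm_def, eLpNorm_congr_ae h1, eLpNorm_congr_ae h2,
    ← ENNReal.toReal_ofReal (show 0 ≤ |C| + 1 by positivity), ← ENNReal.toReal_mul]
  exact ENNReal.toReal_mono
    (ENNReal.mul_ne_top (by simp) (hφ.memLp_gradient _).eLpNorm_ne_top) hP'

/-- Lagrangians `h x s ξ` which are convex and continuous in `(s, ξ)`, and for which the
superposition operator preserves measurability. -/
structure IsConvexIntegrand (μ : Measure (EuclideanSpace ℝ (Fin N)))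
    (h : EuclideanSpace ℝ (Fin N) → ℝ → EuclideanSpace ℝ (Fin N) → ℝ) : Prop where
  convex : ∀ x, ConvexOn ℝ univ fun z : ℝ × EuclideanSpace ℝ (Fin N) => h x z.1 z.2
  cont : ∀ x, Continuous fun z : ℝ × EuclideanSpace ℝ (Fin N) => h x z.1 z.2
  meas : ∀ (s : EuclideanSpace ℝ (Fin N) → ℝ) (ξ : EuclideanSpace ℝ (Fin N) →
    EuclideanSpace ℝ (Fin N)), AEMeasurable s μ → AEMeasurable ξ μ →
    AEMeasurable (fun x => h x (s x) (ξ x)) μ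

lemma IsConvexIntegrand.add {μ : Measure (EuclideanSpace ℝ (Fin N))}
    {h k : EuclideanSpace ℝ (Fin N) → ℝ → EuclideanSpace ℝ (Fin N) → ℝ}
    (hh : IsConvexIntegrand μ h) (hk : IsConvexIntegrand μ k) :
    IsConvexIntegrand μ fun x s ξ => h x s ξ + k x s ξ :=
  ⟨fun x => (hh.convex x).add (hk.convex x), fun x => (hh.cont x).add (hk.cont x),
    fun s ξ hs hξ => (hh.meas s ξ hs hξ).add (hk.meas s ξ hs hξ)⟩

lemma isConvexIntegrand_zero (μ : Measure (EuclideanSpace ℝ (Fin N))) :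
    IsConvexIntegrand μ fun _ _ _ => 0 :=
  ⟨fun _ => convexOn_const _ convex_univ, fun _ => continuous_const,
    fun _ _ _ _ => aemeasurable_const⟩

lemma convexOn_affine_comp {g : ℝ → ℝ} (hg : ConvexOn ℝ univ g) (c : ℝ) :
    ConvexOn ℝ univ fun z : ℝ × EuclideanSpace ℝ (Fin N) => g (z.1 - c) := by
  refine ⟨convex_univ, fun x _ y _ a b ha hb hab => ?_⟩
  have := hg.2 (mem_univ (x.1 - c)) (mem_univ (y.1 - c)) ha hb hab
  convert this using 2
  simp only [Prod.fst_add, Prod.smul_fst, smul_eq_mul]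
  linear_combination c * hab

lemma isConvexIntegrand_sq {μ : Measure (EuclideanSpace ℝ (Fin N))} (hv : AEMeasurable v μ) :
    IsConvexIntegrand μ fun x s _ => (s - v x) ^ 2 :=
  ⟨fun x => convexOn_affine_comp (Even.convexOn_pow even_two) (v x), fun x => by fun_prop,
    fun s ξ hs hξ => (hs.sub hv).pow_const 2⟩

lemma isConvexIntegrand_abs {μ : Measure (EuclideanSpace ℝ (Fin N))} (hv : AEMeasurable v μ) :
    IsConvexIntegrand μ fun x s _ => |s - v x| :=
  ⟨fun x => convexOn_affine_comp (convexOn_norm convex_univ) (v x), fun x => by fun_prop,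
    fun s ξ hs hξ => (hs.sub hv).abs⟩

lemma isConvexIntegrand_gauge (μ : Measure (EuclideanSpace ℝ (Fin N))) (hKc : Convex ℝ K)
    (hK0 : (0 : EuclideanSpace ℝ (Fin N)) ∈ interior K) (hr : 1 ≤ r) :
    IsConvexIntegrand μ fun _ _ ξ => 1 / r * gauge K ξ ^ r := by
  have hK : K ∈ 𝓝 (0 : EuclideanSpace ℝ (Fin N)) := mem_interior_iff_mem_nhds.1 hK0
  have hc : Continuous fun ξ => 1 / r * gauge K ξ ^ r :=
    continuous_const.mul ((Real.continuous_rpow_const (by linarith)).comp (continuous_gauge hKc hK))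
  refine ⟨fun _ => ⟨convex_univ, fun x _ y _ a b ha hb hab => ?_⟩, fun _ => hc.comp continuous_snd,
    fun s ξ hs hξ => hc.measurable.comp_aemeasurable hξ⟩
  have h1 : gauge K (a • x.2 + b • y.2) ≤ a * gauge K x.2 + b * gauge K y.2 := by
    refine (gauge_add_le hKc (absorbent_nhds_zero hK) _ _).trans_eq ?_
    rw [gauge_smul_of_nonneg ha, gauge_smul_of_nonneg hb, smul_eq_mul, smul_eq_mul]
  have h2 := (convexOn_rpow hr).2 (mem_Ici.2 (gauge_nonneg (s := K) x.2))
    (mem_Ici.2 (gauge_nonneg (s := K) y.2)) ha hb hab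
  have h3 := Real.rpow_le_rpow (gauge_nonneg _) h1 (by linarith : 0 ≤ r)
  simp only [smul_eq_mul, Prod.snd_add, Prod.smul_snd] at h2 ⊢
  calc 1 / r * gauge K (a • x.2 + b • y.2) ^ r
      ≤ 1 / r * (a * gauge K x.2 ^ r + b * gauge K y.2 ^ r) := by
        have : 0 ≤ 1 / r := by positivity
        gcongr
        exact h3.trans h2
    _ = _ := by ring

/-- The integral functional `∫_Ω h(x, v, Dv) dx` on `W^{1,p}_0(Ω)`, whose elements are encoded as
pairs `(v, Dv)`; negative values of `h` count as `0`. -/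
noncomputable def lagrangian [Fact (1 ≤ p)]
    (h : EuclideanSpace ℝ (Fin N) → ℝ → EuclideanSpace ℝ (Fin N) → ℝ)
    (w : sobolevZero Ω p) : ℝ≥0∞ :=
  ∫⁻ x in Ω, ENNReal.ofReal (h x (w.1.1 x) (w.1.2 x))

variable {h : EuclideanSpace ℝ (Fin N) → ℝ → EuclideanSpace ℝ (Fin N) → ℝ}

lemma IsConvexIntegrand.aemeasurable [Fact (1 ≤ p)] (hh : IsConvexIntegrand (volume.restrict Ω) h)
    (w : sobolevZero Ω p) : AEMeasurable (fun x => ENNReal.ofReal (h x (w.1.1 x) (w.1.2 x)))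
      (volume.restrict Ω) :=
  (hh.meas _ _ (Lp.memLp w.1.1).1.aemeasurable (Lp.memLp w.1.2).1.aemeasurable).ennreal_ofReal

lemma Lp_coeFn_smul_add_smul {α F : Type*} [MeasurableSpace α] {μ : Measure α}
    [NormedAddCommGroup F] [NormedSpace ℝ F] (a b : ℝ) (f g : Lp F p μ) :
    ⇑(a • f + b • g) =ᵐ[μ] fun x => a • f x + b • g x :=
  (Lp.coeFn_add _ _).trans ((Lp.coeFn_smul a f).add (Lp.coeFn_smul b g))

lemma IsConvexIntegrand.convex_sublevel [Fact (1 ≤ p)]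
    (hh : IsConvexIntegrand (volume.restrict Ω) h) (c : ℝ≥0∞) :
    Convex ℝ {w : sobolevZero Ω p | lagrangian h w ≤ c} := by
  intro w hw w' hw' a b ha hb hab
  change lagrangian h (a • w + b • w') ≤ c
  have h1 : lagrangian h (a • w + b • w') ≤
      ENNReal.ofReal a * lagrangian h w + ENNReal.ofReal b * lagrangian h w' := by
    calc lagrangian h (a • w + b • w')
        ≤ ∫⁻ x in Ω, (ENNReal.ofReal a * ENNReal.ofReal (h x (w.1.1 x) (w.1.2 x)) +
            ENNReal.ofReal b * ENNReal.ofReal (h x (w'.1.1 x) (w'.1.2 x))) := ?_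
      _ = _ := by
        rw [lintegral_add_left' ((hh.aemeasurable w).const_mul _),
          lintegral_const_mul'' _ (hh.aemeasurable w), lintegral_const_mul'' _ (hh.aemeasurable w')]
        rfl
    refine lintegral_mono_ae ?_
    have e1 : (a • w + b • w').1.1 = a • w.1.1 + b • w'.1.1 := rfl
    have e2 : (a • w + b • w').1.2 = a • w.1.2 + b • w'.1.2 := rfl
    filter_upwards [Lp_coeFn_smul_add_smul a b w.1.1 w'.1.1,
      Lp_coeFn_smul_add_smul a b w.1.2 w'.1.2] with x h1 h2
    rw [e1, e2, h1, h2, ← ENNReal.ofReal_mul ha, ← ENNReal.ofReal_mul hb]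
    refine (ENNReal.ofReal_le_ofReal ?_).trans ENNReal.ofReal_add_le
    exact (hh.convex x).2 (mem_univ (w.1.1 x, w.1.2 x)) (mem_univ (w'.1.1 x, w'.1.2 x)) ha hb hab
  refine h1.trans ?_
  calc _ ≤ ENNReal.ofReal a * c + ENNReal.ofReal b * c := by
        gcongr
        exacts [hw, hw']
    _ = c := by rw [← add_mul, ← ENNReal.ofReal_add ha hb, hab, ENNReal.ofReal_one, one_mul]

/-- Strong lower semicontinuity, by Fatou's lemma along an almost everywhere convergent
subsequence. -/
lemma IsConvexIntegrand.isClosed_sublevel [Fact (1 ≤ p)]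
    (hh : IsConvexIntegrand (volume.restrict Ω) h) (c : ℝ≥0∞) :
    IsClosed {w : sobolevZero Ω p | lagrangian h w ≤ c} := by
  refine IsSeqClosed.isClosed fun w w₀ hw hlim => ?_
  have hval : Tendsto (fun n => (w n).1) atTop (𝓝 w₀.1) := (continuous_subtype_val.tendsto _).comp hlim
  have t1 : TendstoInMeasure (volume.restrict Ω) (fun n => ⇑(w n).1.1) atTop w₀.1.1 :=
    tendstoInMeasure_of_tendsto_Lp ((continuous_fst.tendsto _).comp hval)
  obtain ⟨n₁, hn₁, ha₁⟩ := t1.exists_seq_tendsto_ae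
  have t2 : TendstoInMeasure (volume.restrict Ω) (fun k => ⇑(w (n₁ k)).1.2) atTop w₀.1.2 :=
    tendstoInMeasure_of_tendsto_Lp
      (((continuous_snd.tendsto _).comp hval).comp hn₁.tendsto_atTop)
  obtain ⟨n₂, hn₂, ha₂⟩ := t2.exists_seq_tendsto_ae
  change lagrangian h w₀ ≤ c
  calc lagrangian h w₀
      ≤ ∫⁻ x in Ω, liminf (fun k => ENNReal.ofReal
          (h x ((w (n₁ (n₂ k))).1.1 x) ((w (n₁ (n₂ k))).1.2 x))) atTop := by
        refine lintegral_mono_ae ?_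
        filter_upwards [ha₁, ha₂] with x h1 h2
        refine le_of_eq (Tendsto.liminf_eq ?_).symm
        exact ENNReal.tendsto_ofReal (((hh.cont x).tendsto (w₀.1.1 x, w₀.1.2 x)).comp
          ((h1.comp hn₂.tendsto_atTop).prodMk_nhds h2))
    _ ≤ liminf (fun k => lagrangian h (w (n₁ (n₂ k)))) atTop :=
        lintegral_liminf_le' fun k => hh.aemeasurable _
    _ ≤ c := by
        refine (liminf_le_liminf (.of_forall fun k => hw (n₁ (n₂ k)))).trans ?_
        simp

end Energies
end SobolevGamma

namespace SobolevGamma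

variable {N : ℕ} {Ω K : Set (EuclideanSpace ℝ (Fin N))} {p q : ℝ≥0∞}

/-! ### The functionals `G_p` and `J_p` -/

section PowerEnergies

variable {v : EuclideanSpace ℝ (Fin N) → ℝ} {r s : ℝ}
  {ℓ : EuclideanSpace ℝ (Fin N) → ℝ → ℝ}

open Classical in
/-- The functional `∫_Ω [(1/r) ρ_K(Dv)^r + ℓ(x, v)] dx` on `W^{1,r}_0(Ω)`, and `+∞` elsewhere; it is
`G_r` for `ℓ = 0` and `J_r` for `ℓ(x, s) = (s - ū(x))^2`. -/
noncomputable def energy (Ω K : Set (EuclideanSpace ℝ (Fin N)))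
    (ℓ : EuclideanSpace ℝ (Fin N) → ℝ → ℝ) (r : ℝ)
    (v : EuclideanSpace ℝ (Fin N) → ℝ) : ℝ≥0∞ :=
  if MemSobolevZeroFin Ω (ENNReal.ofReal r) v then
    ∫⁻ x in Ω, ENNReal.ofReal (1 / r * gauge K (weakGradient Ω v x) ^ r + ℓ x (v x))
  else ⊤

lemma memSobolevZero_ofReal :
    MemSobolevZero Ω (ENNReal.ofReal r) v ↔ MemSobolevZeroFin Ω (ENNReal.ofReal r) v := by
  simp [MemSobolevZero]

lemma powerEnergy_eq_energy : powerEnergy Ω K r v = energy Ω K (fun _ _ => 0) r v := by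
  by_cases h : MemSobolevZeroFin Ω (ENNReal.ofReal r) v
  · simp [powerEnergy, energy, memSobolevZero_ofReal, h]
  · simp [powerEnergy, energy, memSobolevZero_ofReal, h]

lemma powerFidelity_eq_energy (ubar : EuclideanSpace ℝ (Fin N) → ℝ) :
    powerFidelity Ω K ubar r v = energy Ω K (fun x s => (s - ubar x) ^ 2) r v := by
  by_cases h : MemSobolevZeroFin Ω (ENNReal.ofReal r) v
  · simp [powerFidelity, energy, memSobolevZero_ofReal, h]
  · simp [powerFidelity, energy, memSobolevZero_ofReal, h]

lemma memSobolevZeroFin_of_energy_ne_top (h : energy Ω K ℓ r v ≠ ⊤) :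
    MemSobolevZeroFin Ω (ENNReal.ofReal r) v := by
  by_contra hv
  exact h (if_neg hv)

lemma energy_of_mem (h : MemSobolevZeroFin Ω (ENNReal.ofReal r) v) : energy Ω K ℓ r v =
    ∫⁻ x in Ω, ENNReal.ofReal (1 / r * gauge K (weakGradient Ω v x) ^ r + ℓ x (v x)) :=
  if_pos h

lemma lintegral_le_energy (hr : 0 < r) :
    ∫⁻ x in Ω, ENNReal.ofReal (ℓ x (v x)) ≤ energy Ω K ℓ r v := by
  by_cases h : MemSobolevZeroFin Ω (ENNReal.ofReal r) v
  · rw [energy_of_mem h]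
    refine lintegral_mono fun x => ENNReal.ofReal_le_ofReal (le_add_of_nonneg_left ?_)
    have := gauge_nonneg (s := K) (weakGradient Ω v x)
    positivity
  · rw [energy, if_neg h]; exact le_top

lemma energy_eq_lagrangian [IsFiniteMeasure (volume.restrict Ω)] (hΩ : IsOpen Ω)
    [Fact (1 ≤ ENNReal.ofReal r)] {w : sobolevZero Ω (ENNReal.ofReal r)}
    (hw : w.1.1 =ᵐ[volume.restrict Ω] v) :
    energy Ω K ℓ r v = lagrangian (fun x s ξ => 1 / r * gauge K ξ ^ r + ℓ x s) w := by
  rw [energy_of_mem ⟨‹_›, w, hw⟩]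
  refine lintegral_congr_ae ?_
  filter_upwards [hw, weakGradient_ae_eq_of_mem hΩ w.2 hw] with x h1 h2
  rw [← h1, h2]

lemma exists_lagrangian_eq_energy [IsFiniteMeasure (volume.restrict Ω)] (hΩ : IsOpen Ω)
    [Fact (1 ≤ ENNReal.ofReal r)] (h : energy Ω K ℓ r v ≠ ⊤) :
    ∃ w : sobolevZero Ω (ENNReal.ofReal r), w.1.1 =ᵐ[volume.restrict Ω] v ∧
      lagrangian (fun x s ξ => 1 / r * gauge K ξ ^ r + ℓ x s) w = energy Ω K ℓ r v := by
  obtain ⟨_, w, hw⟩ := memSobolevZeroFin_of_energy_ne_top h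
  exact ⟨w, hw, (energy_eq_lagrangian hΩ hw).symm⟩

/-- Young's inequality, in the form that makes `r ↦ t ^ r / r - 1 / r` nondecreasing. -/
lemma one_div_mul_rpow_le (hr : 0 < r) (hrs : r ≤ s) {t : ℝ} (ht : 0 ≤ t) :
    1 / r * t ^ r ≤ 1 / s * t ^ s + (1 / r - 1 / s) := by
  have hs : 0 < s := hr.trans_le hrs
  have h := Real.geom_mean_le_arith_mean2_weighted (w₁ := r / s) (w₂ := 1 - r / s)
    (p₁ := t ^ s) (p₂ := 1) (by positivity) (by rw [sub_nonneg, div_le_one hs]; exact hrs)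
    (by positivity) zero_le_one (by ring)
  rw [Real.one_rpow, mul_one, mul_one, ← Real.rpow_mul ht, mul_div_cancel₀ _ hs.ne'] at h
  calc 1 / r * t ^ r ≤ 1 / r * (r / s * t ^ s + (1 - r / s)) := by gcongr
    _ = 1 / s * t ^ s + (1 / r - 1 / s) := by field_simp

/-- Up to the term `|Ω| / r`, the energies are nondecreasing in the exponent, so a bound for large
exponents is a bound for all of them. -/
lemma energy_le_energy_add [IsFiniteMeasure (volume.restrict Ω)] (hr : 1 ≤ r) (hrs : r ≤ s) :
    energy Ω K ℓ r v ≤ energy Ω K ℓ s v + ENNReal.ofReal (1 / r - 1 / s) * volume Ω := by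
  by_cases h : MemSobolevZeroFin Ω (ENNReal.ofReal s) v
  · rw [energy_of_mem h, energy_of_mem (h.of_exponent_le (by simpa using hr)
      (ENNReal.ofReal_le_ofReal hrs))]
    calc _ ≤ ∫⁻ x in Ω, (ENNReal.ofReal (1 / s * gauge K (weakGradient Ω v x) ^ s + ℓ x (v x)) +
            ENNReal.ofReal (1 / r - 1 / s)) := by
          refine lintegral_mono fun x =>
            (ENNReal.ofReal_le_ofReal ?_).trans ENNReal.ofReal_add_le
          have := one_div_mul_rpow_le (by linarith) hrs (gauge_nonneg (s := K) (weakGradient Ω v x))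
          linarith
      _ = _ := by
          rw [lintegral_add_right _ measurable_const]; simp
  · rw [energy.eq_def Ω K ℓ s, if_neg h]; simp

lemma energy_le_of_gauge_le_one [IsFiniteMeasure (volume.restrict Ω)] (hr : 1 ≤ r)
    (h : MemSobolevZeroFin Ω (ENNReal.ofReal r) v)
    (hv : ∀ᵐ x ∂(volume.restrict Ω), gauge K (weakGradient Ω v x) ≤ 1) :
    energy Ω K ℓ r v ≤
      (∫⁻ x in Ω, ENNReal.ofReal (ℓ x (v x))) + ENNReal.ofReal (1 / r) * volume Ω := by
  rw [energy_of_mem h]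
  calc _ ≤ ∫⁻ x in Ω, (ENNReal.ofReal (ℓ x (v x)) + ENNReal.ofReal (1 / r)) := by
        refine lintegral_mono_ae ?_
        filter_upwards [hv] with x hx
        rw [add_comm]
        refine (ENNReal.ofReal_le_ofReal (add_le_add_right ?_ _)).trans ENNReal.ofReal_add_le
        have := Real.rpow_le_one (gauge_nonneg _) hx (by linarith : 0 ≤ r)
        have h0 : 0 ≤ 1 / r := by positivity
        nlinarith
    _ = _ := by rw [lintegral_add_right _ measurable_const]; simp

lemma lintegral_norm_div_rpow {α F : Type*} [MeasurableSpace α] {μ : Measure α}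
    [NormedAddCommGroup F] (hr : 0 < r) {A : ℝ} (hA : 0 < A) (f : Lp F (ENNReal.ofReal r) μ) :
    ∫⁻ x, ENNReal.ofReal (1 / r * (‖f x‖ / A) ^ r) ∂μ =
      ENNReal.ofReal (1 / r * (‖f‖ / A) ^ r) := by
  have e : ∀ t : ℝ, 0 ≤ t → 1 / r * (t / A) ^ r = 1 / r / A ^ r * t ^ r := fun t ht => by
    rw [Real.div_rpow ht hA.le]; ring
  simp_rw [fun x => e _ (norm_nonneg (f x))]
  rw [e _ (show 0 ≤ ‖f‖ from ENNReal.toReal_nonneg), norm_rpow_eq_integral hr, ← integral_const_mul,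
    ofReal_integral_eq_lintegral_ofReal ((integrable_norm_rpow_coeFn hr f).const_mul _)
      (.of_forall fun x => by positivity)]

/-- The part of `energy` in which the gradient enters controls the norm of the gradient. -/
lemma ofReal_norm_snd_le_lagrangian (hK0 : 0 ∈ interior K) {R : ℝ} (hR : 0 < R)
    (hKR : K ⊆ Metric.closedBall 0 R) (hℓ : ∀ x s, 0 ≤ ℓ x s) (hr : 0 < r)
    [Fact (1 ≤ ENNReal.ofReal r)] (w : sobolevZero Ω (ENNReal.ofReal r)) :
    ENNReal.ofReal (1 / r * (‖w.1.2‖ / R) ^ r) ≤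
      lagrangian (fun x s ξ => 1 / r * gauge K ξ ^ r + ℓ x s) w := by
  rw [← lintegral_norm_div_rpow hr hR]
  refine lintegral_mono fun x => ENNReal.ofReal_le_ofReal ?_
  refine le_add_of_le_of_nonneg ?_ (hℓ _ _)
  have := le_gauge_of_subset_closedBall (absorbent_nhds_zero (mem_interior_iff_mem_nhds.1 hK0))
    hR.le hKR (x := w.1.2 x)
  gcongr

/-- Weak compactness: a sequence with bounded energies has a weak limit point, which lies in each
closed convex set that contains all but finitely many terms. -/
lemma exists_weak_limit (hN : 0 < N) (hΩ : IsOpen Ω) (hΩb : Bornology.IsBounded Ω)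
    (hK : IsCompact K) (hK0 : 0 ∈ interior K) (hℓ : ∀ x s, 0 ≤ ℓ x s)
    (hr : 1 < r) [Fact (1 ≤ ENNReal.ofReal r)] {w : ℕ → sobolevZero Ω (ENNReal.ofReal r)}
    {c : ℝ≥0∞} (hc : c ≠ ⊤)
    (hw : ∀ n, lagrangian (fun x s ξ => 1 / r * gauge K ξ ^ r + ℓ x s) (w n) ≤ c) :
    ∃ y, ∀ C : Set (sobolevZero Ω (ENNReal.ofReal r)), Convex ℝ C → IsClosed C →
      (∀ᶠ n in atTop, w n ∈ C) → y ∈ C := by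
  obtain ⟨D, hD, hP⟩ := exists_norm_fst_le hN hΩ.measurableSet hΩb
  have hr0 : 0 < r := by linarith
  obtain ⟨R, hR, hKR⟩ := hK.isBounded.subset_closedBall_lt 0 0
  have : CompleteSpace (sobolevZero Ω (ENNReal.ofReal r)) :=
    (Submodule.isClosed_topologicalClosure _).completeSpace_coe
  refine exists_mem_of_eventually_mem
    ((LinearMap.snd ℝ _ _).comp (sobolevZero Ω (ENNReal.ofReal r)).subtype)
    (D := max D 1) (by positivity) (fun x => ?_) hr0
    (fun ε hε => exists_Lp_norm_sub_rpow_le hr hε) (M := R * (r * c.toReal) ^ (1 / r))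
    (fun n => ?_)
  · change ‖x.1‖ ≤ max D 1 * ‖x.1.2‖
    rw [Prod.norm_def]
    refine max_le ((hP r hr.le x).trans ?_) ?_
    · gcongr; exact le_max_left _ _
    · exact le_mul_of_one_le_left (norm_nonneg _) (le_max_right _ _)
  · change ‖(w n).1.2‖ ≤ _
    have h1 := (ofReal_norm_snd_le_lagrangian hK0 hR hKR hℓ hr0 (w n)).trans (hw n)
    rw [ENNReal.ofReal_le_iff_le_toReal hc, one_div_mul_eq_div, div_le_iff₀ hr0, mul_comm] at h1
    rw [← div_le_iff₀' hR]
    have h2 := Real.rpow_le_rpow (by positivity) h1 (show 0 ≤ 1 / r by positivity)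
    rwa [← Real.rpow_mul (by positivity), mul_one_div_cancel hr0.ne', Real.rpow_one] at h2

lemma ae_eq_of_forall_lintegral_le {α : Type*} [MeasurableSpace α] {μ : Measure α}
    {f g : α → ℝ} (hf : AEMeasurable f μ) (hg : AEMeasurable g μ)
    (h : ∀ ε : ℝ≥0∞, 0 < ε → ∫⁻ x, ENNReal.ofReal |f x - g x| ∂μ ≤ ε) : f =ᵐ[μ] g := by
  have h0 : ∫⁻ x, ENNReal.ofReal |f x - g x| ∂μ = 0 :=
    le_antisymm (le_of_forall_pos_le_add fun ε hε => by simpa using h ε hε) zero_le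
  have hm : AEMeasurable (fun x => ENNReal.ofReal |f x - g x|) μ := (hf.sub hg).abs.ennreal_ofReal
  filter_upwards [(lintegral_eq_zero_iff' hm).1 h0] with x hx
  simpa [sub_eq_zero] using hx

/-- Weak limit points are identified by convergence of the functions in `L^1(Ω)`. -/
lemma exists_weak_limit_of_tendsto (hN : 0 < N) (hΩ : IsOpen Ω) (hΩb : Bornology.IsBounded Ω)
    (hK : IsCompact K) (hK0 : 0 ∈ interior K) (hℓ : ∀ x s, 0 ≤ ℓ x s)
    (hr : 1 < r) [Fact (1 ≤ ENNReal.ofReal r)] {w : ℕ → sobolevZero Ω (ENNReal.ofReal r)}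
    {c : ℝ≥0∞} (hc : c ≠ ⊤)
    (hw : ∀ n, lagrangian (fun x s ξ => 1 / r * gauge K ξ ^ r + ℓ x s) (w n) ≤ c)
    (hv : AEMeasurable v (volume.restrict Ω))
    (hlim : Tendsto (fun n => ∫⁻ x in Ω, ENNReal.ofReal |(w n).1.1 x - v x|) atTop (𝓝 0)) :
    ∃ y : sobolevZero Ω (ENNReal.ofReal r), y.1.1 =ᵐ[volume.restrict Ω] v ∧
      ∀ C : Set (sobolevZero Ω (ENNReal.ofReal r)), Convex ℝ C → IsClosed C →
        (∀ᶠ n in atTop, w n ∈ C) → y ∈ C := by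
  obtain ⟨y, hy⟩ := exists_weak_limit hN hΩ hΩb hK hK0 hℓ hr hc hw
  refine ⟨y, ae_eq_of_forall_lintegral_le (Lp.memLp y.1.1).1.aemeasurable hv fun ε hε => ?_, hy⟩
  have hI := isConvexIntegrand_abs hv
  exact hy _ (hI.convex_sublevel ε) (hI.isClosed_sublevel ε) (hlim.eventually_le_const hε)

/-- Lower semicontinuity of the energy for convergence in `L^1(Ω)`. -/
lemma energy_le_of_tendsto (hN : 0 < N) (hΩ : IsOpen Ω) (hΩb : Bornology.IsBounded Ω)
    (hK : IsCompact K) (hKc : Convex ℝ K) (hK0 : 0 ∈ interior K) (hℓ : ∀ x s, 0 ≤ ℓ x s)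
    (hℓc : IsConvexIntegrand (volume.restrict Ω) fun x s _ => ℓ x s)
    (hr : 1 < r) {u : ℕ → EuclideanSpace ℝ (Fin N) → ℝ} {c : ℝ≥0∞} (hc : c ≠ ⊤)
    (hu : ∀ᶠ n in atTop, energy Ω K ℓ r (u n) ≤ c) (hv : AEMeasurable v (volume.restrict Ω))
    (hlim : Tendsto (fun n => ∫⁻ x in Ω, ENNReal.ofReal |u n x - v x|) atTop (𝓝 0)) :
    energy Ω K ℓ r v ≤ c := by
  have : IsFiniteMeasure (volume.restrict Ω) := ⟨by simpa using hΩb.measure_lt_top⟩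
  have : Fact (1 ≤ ENNReal.ofReal r) := ⟨by simpa using hr.le⟩
  obtain ⟨n₀, hn₀⟩ := eventually_atTop.1 hu
  have hex : ∀ n, ∃ w : sobolevZero Ω (ENNReal.ofReal r), w.1.1 =ᵐ[volume.restrict Ω] u (n + n₀) ∧
      lagrangian (fun x s ξ => 1 / r * gauge K ξ ^ r + ℓ x s) w ≤ c := fun n => by
    have hn := hn₀ (n + n₀) (by omega)
    obtain ⟨w, h1, h2⟩ := exists_lagrangian_eq_energy hΩ (ne_top_of_le_ne_top hc hn)
    exact ⟨w, h1, h2.trans_le hn⟩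
  choose w hw1 hw2 using hex
  obtain ⟨y, hyv, hy⟩ := exists_weak_limit_of_tendsto hN hΩ hΩb hK hK0 hℓ hr hc hw2 hv (by
    refine ((tendsto_add_atTop_iff_nat n₀).2 hlim).congr fun n => lintegral_congr_ae ?_
    filter_upwards [hw1 n] with x hx
    rw [hx])
  rw [energy_eq_lagrangian hΩ hyv]
  have hI := (isConvexIntegrand_gauge (volume.restrict Ω) hKc hK0 hr.le).add hℓc
  exact hy _ (hI.convex_sublevel c) (hI.isClosed_sublevel c) (.of_forall hw2)

end PowerEnergies
end SobolevGamma

namespace SobolevGamma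

variable {N : ℕ} {Ω K : Set (EuclideanSpace ℝ (Fin N))} {p q : ℝ≥0∞}

/-! ### Passage to the limit in the exponent -/

section Limit

variable {v : EuclideanSpace ℝ (Fin N) → ℝ} {r s : ℝ}

/-- A function whose integrals `∫ f ^ r / r` stay bounded as `r → ∞` is at most `1`: by Chebyshev's
inequality, `μ {a ≤ f} ≤ c r / a ^ r` for all `r`. -/
lemma ae_le_one_of_forall_lintegral_rpow_le {α : Type*} [MeasurableSpace α] {μ : Measure α}
    {f : α → ℝ} (hf : AEMeasurable f μ) {c : ℝ≥0∞} (hc : c ≠ ⊤)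
    (h : ∀ r : ℝ, 1 < r → ∫⁻ x, ENNReal.ofReal (1 / r * f x ^ r) ∂μ ≤ c) :
    ∀ᵐ x ∂μ, f x ≤ 1 := by
  have key : ∀ a : ℝ, 1 < a → ∀ᵐ x ∂μ, f x < a := fun a ha => by
    have hle : ∀ n : ℕ, 2 ≤ n → μ {x | a ≤ f x} ≤ ENNReal.ofReal (n ^ 1 / a ^ n) * c := fun n hn => by
      have hn0 : (0 : ℝ) < n := by positivity
      have hn1 : (1 : ℝ) < n := by exact_mod_cast hn
      have h1 : ENNReal.ofReal (1 / n * a ^ n) * μ {x | a ≤ f x} ≤ c := by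
        refine le_trans ?_ (h n hn1)
        refine le_trans ?_ (mul_meas_ge_le_lintegral₀
          ((hf.pow_const (n : ℝ)).const_mul (1 / (n : ℝ))).ennreal_ofReal
          (ENNReal.ofReal (1 / n * a ^ n)))
        gcongr with x
        intro hx
        refine ENNReal.ofReal_le_ofReal ?_
        rw [Real.rpow_natCast]
        gcongr
      calc μ {x | a ≤ f x}
          = ENNReal.ofReal (n ^ 1 / a ^ n) * (ENNReal.ofReal (1 / n * a ^ n) * μ {x | a ≤ f x}) := by
            rw [← mul_assoc, ← ENNReal.ofReal_mul (by positivity)]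
            have : (n : ℝ) ^ 1 / a ^ n * (1 / n * a ^ n) = 1 := by field_simp
            rw [this, ENNReal.ofReal_one, one_mul]
        _ ≤ _ := by gcongr
    have hlim : Tendsto (fun n : ℕ => ENNReal.ofReal ((n : ℝ) ^ 1 / a ^ n) * c) atTop (𝓝 0) := by
      have := ENNReal.Tendsto.mul_const (b := c) (ENNReal.tendsto_ofReal
        (tendsto_pow_const_div_const_pow_of_one_lt 1 ha)) (Or.inr hc)
      simpa using this
    have h0 : μ {x | a ≤ f x} = 0 := le_antisymm
      (ge_of_tendsto hlim (eventually_atTop.2 ⟨2, hle⟩)) zero_le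
    rw [ae_iff]
    simpa using h0
  have hall : ∀ᵐ x ∂μ, ∀ n : ℕ, f x < 1 + 1 / ((n : ℝ) + 1) :=
    ae_all_iff.2 fun n => key _ (lt_add_of_pos_right _ (by positivity))
  filter_upwards [hall] with x hx
  refine ge_of_tendsto' (f := fun n : ℕ => 1 + 1 / ((n : ℝ) + 1)) (x := atTop) ?_ fun n => (hx n).le
  simpa using tendsto_one_div_add_atTop_nhds_zero_nat.const_add (1 : ℝ)

/-- If the energies stay bounded as `r → ∞`, then `v` is admissible for the gradient constraint.
Boundedness of `v` itself comes from Poincaré's inequality, whose constant does not depend on `r`. -/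
lemma constraint_of_energy_le (hN : 0 < N) (hΩ : IsOpen Ω) (hΩb : Bornology.IsBounded Ω)
    (hK : IsCompact K) (hKc : Convex ℝ K) (hK0 : 0 ∈ interior K) {c : ℝ≥0∞} (hc : c ≠ ⊤)
    (h : ∀ r : ℝ, 1 < r → energy Ω K (fun _ _ => 0) r v ≤ c) :
    MemSobolevZero Ω ⊤ v ∧ ∀ᵐ x ∂(volume.restrict Ω), weakGradient Ω v x ∈ K := by
  have : IsFiniteMeasure (volume.restrict Ω) := ⟨by simpa using hΩb.measure_lt_top⟩
  have hKn : K ∈ 𝓝 (0 : EuclideanSpace ℝ (Fin N)) := mem_interior_iff_mem_nhds.1 hK0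
  obtain ⟨D, hD, hP⟩ := exists_norm_fst_le hN hΩ.measurableSet hΩb
  obtain ⟨R, hR, hKR⟩ := hK.isBounded.subset_closedBall_lt 0 0
  have hmem : ∀ r : ℝ, 1 < r → MemSobolevZeroFin Ω (ENNReal.ofReal r) v := fun r hr =>
    memSobolevZeroFin_of_energy_ne_top (ne_top_of_le_ne_top hc (h r hr))
  obtain ⟨hF, w, hw⟩ := hmem 2 one_lt_two
  have hgw := weakGradient_ae_eq_of_mem hΩ w.2 hw
  have hvm : AEStronglyMeasurable v (volume.restrict Ω) := (Lp.memLp w.1.1).1.congr hw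
  have hgm : AEStronglyMeasurable (weakGradient Ω v) (volume.restrict Ω) :=
    (Lp.memLp w.1.2).1.congr hgw.symm
  have hgK : ∀ᵐ x ∂(volume.restrict Ω), weakGradient Ω v x ∈ K := by
    have := ae_le_one_of_forall_lintegral_rpow_le (f := fun x => gauge K (weakGradient Ω v x))
      ((continuous_gauge hKc hKn).measurable.comp_aemeasurable hgm.aemeasurable) hc
      fun r hr => by
        refine le_trans (le_of_eq ?_) (h r hr)
        rw [energy_of_mem (hmem r hr)]
        simp
    filter_upwards [this] with x hx
    have := (gauge_le_one_iff_mem_closure hKc hKn).1 hx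
    rwa [hK.isClosed.closure_eq] at this
  have hvb : ∀ᵐ x ∂(volume.restrict Ω), ‖v x‖ / (D * R) ≤ 1 := by
    refine ae_le_one_of_forall_lintegral_rpow_le (hvm.norm.aemeasurable.div_const _) hc
      fun r hr => ?_
    obtain ⟨_, w, hw⟩ := hmem r hr
    have hr0 : 0 < r := by linarith
    calc ∫⁻ x in Ω, ENNReal.ofReal (1 / r * (‖v x‖ / (D * R)) ^ r)
        = ∫⁻ x in Ω, ENNReal.ofReal (1 / r * (‖w.1.1 x‖ / (D * R)) ^ r) :=
          lintegral_congr_ae (by filter_upwards [hw] with x hx; rw [hx])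
      _ = ENNReal.ofReal (1 / r * (‖w.1.1‖ / (D * R)) ^ r) :=
          lintegral_norm_div_rpow hr0 (by positivity) _
      _ ≤ ENNReal.ofReal (1 / r * (‖w.1.2‖ / R) ^ r) := by
          refine ENNReal.ofReal_le_ofReal ?_
          have h1 : ‖w.1.1‖ / (D * R) ≤ ‖w.1.2‖ / R := by
            rw [div_le_div_iff₀ (by positivity) hR]
            nlinarith [hP r hr.le w]
          gcongr
      _ ≤ c := (ofReal_norm_snd_le_lagrangian hK0 hR hKR (ℓ := fun _ _ => 0) (fun _ _ => le_rfl)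
          hr0 w).trans ((energy_eq_lagrangian hΩ hw).symm.trans_le (h r hr))
  refine ⟨?_, hgK⟩
  rw [MemSobolevZero, if_pos rfl]
  refine ⟨⟨memLp_top_of_bound hvm (D * R) ?_, weakGradient Ω v, memLp_top_of_bound hgm R ?_,
    ?_⟩, fun q hq hq' => ?_⟩
  · filter_upwards [hvb] with x hx
    rwa [div_le_one (by positivity)] at hx
  · filter_upwards [hgK] with x hx
    simpa using hKR hx
  · have hwg := (hasWeakGradient_of_mem w.2).congr_ae hΩ hw
    rw [weakGradient, dif_pos ⟨_, hwg⟩]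
    exact (⟨_, hwg⟩ : ∃ g, HasWeakGradient Ω v g).choose_spec
  · refine (hmem (q.toReal + 1) ?_).of_exponent_le hq ?_
    · have := ENNReal.toReal_mono hq' hq
      rw [ENNReal.toReal_one] at this
      linarith
    · rw [← ENNReal.ofReal_toReal hq']
      exact ENNReal.ofReal_le_ofReal (by simp)

/-- `L^1`-limits of functions whose energies with exponents tending to `∞` stay bounded. -/
lemma constraint_of_tendsto (hN : 0 < N) (hΩ : IsOpen Ω) (hΩb : Bornology.IsBounded Ω)
    (hK : IsCompact K) (hKc : Convex ℝ K) (hK0 : 0 ∈ interior K) {c : ℝ≥0∞} (hc : c ≠ ⊤)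
    {u : ℕ → EuclideanSpace ℝ (Fin N) → ℝ} {e : ℕ → ℝ} (he : Tendsto e atTop atTop)
    (hu : ∀ n, energy Ω K (fun _ _ => 0) (e n) (u n) ≤ c)
    (hv : AEMeasurable v (volume.restrict Ω))
    (hlim : Tendsto (fun n => ∫⁻ x in Ω, ENNReal.ofReal |u n x - v x|) atTop (𝓝 0)) :
    MemSobolevZero Ω ⊤ v ∧ ∀ᵐ x ∂(volume.restrict Ω), weakGradient Ω v x ∈ K := by
  have : IsFiniteMeasure (volume.restrict Ω) := ⟨by simpa using hΩb.measure_lt_top⟩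
  have hc' : c + volume Ω ≠ ⊤ := ENNReal.add_ne_top.2 ⟨hc, hΩb.measure_lt_top.ne⟩
  refine constraint_of_energy_le hN hΩ hΩb hK hKc hK0 hc' fun r hr => ?_
  refine energy_le_of_tendsto hN hΩ hΩb hK hKc hK0 (fun _ _ => le_rfl)
    (isConvexIntegrand_zero _) hr hc' ?_ hv hlim
  filter_upwards [he.eventually_ge_atTop r] with n hn
  refine (energy_le_energy_add hr.le hn).trans (add_le_add (hu n) ?_)
  refine mul_le_of_le_one_left' (ENNReal.ofReal_le_one.2 ?_)
  have h1 : 0 ≤ 1 / e n := by have := hr.trans_le hn; positivity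
  have h2 : 1 / r ≤ 1 := by rw [div_le_one (by linarith)]; exact hr.le
  linarith

end Limit
end SobolevGamma

namespace SobolevGamma

variable {N : ℕ} {Ω K : Set (EuclideanSpace ℝ (Fin N))} {p q : ℝ≥0∞}

/-! ### Bounded gradients and Lipschitz functions -/

section Lipschitz

open scoped Convolution

variable {v : EuclideanSpace ℝ (Fin N) → ℝ} {r s : ℝ} {M : NNReal}

/-- Mollifications of a weakly differentiable function with a bounded gradient are Lipschitz. -/
lemma lipschitzWith_convolution {f : EuclideanSpace ℝ (Fin N) → ℝ}
    {g : EuclideanSpace ℝ (Fin N) → EuclideanSpace ℝ (Fin N)}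
    (hf : LocallyIntegrable f) (hg : LocallyIntegrable g) (hgM : ∀ᵐ x, ‖g x‖ ≤ M)
    (hfg : ∀ φ : EuclideanSpace ℝ (Fin N) → ℝ, ContDiff ℝ ∞ φ → HasCompactSupport φ →
      ∫ x, f x • gradient φ x = - ∫ x, φ x • g x)
    (φ : ContDiffBump (0 : EuclideanSpace ℝ (Fin N))) :
    LipschitzWith M (φ.normed volume ⋆[ContinuousLinearMap.lsmul ℝ ℝ, volume] f) := by
  set L : ℝ →L[ℝ] ℝ →L[ℝ] ℝ := ContinuousLinearMap.lsmul ℝ ℝ with hL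
  have hφ : ContDiff ℝ ∞ (φ.normed volume) := φ.contDiff_normed
  have hφc : HasCompactSupport (φ.normed volume) := φ.hasCompactSupport_normed
  rw [← convolution_flip]
  have hder := fun x => hφc.hasFDerivAt_convolution_right L.flip hf (hφ.of_le (by simp)) x
  refine lipschitzWith_of_nnnorm_fderiv_le (𝕜 := ℝ) (fun x => (hder x).differentiableAt) fun x => ?_
  rw [(hder x).fderiv, ← NNReal.coe_le_coe, coe_nnnorm]
  refine ContinuousLinearMap.opNorm_le_bound _ M.2 fun e => ?_
  rw [convolution_precompR_apply _ hf (hφc.fderiv (𝕜 := ℝ)) (hφ.continuous_fderiv (by simp)),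
    convolution_def]
  -- the test function `y ↦ φ (x - y)`
  set ψ : EuclideanSpace ℝ (Fin N) → ℝ := fun y => φ.normed volume (x - y) with hψ
  have hψs : ContDiff ℝ ∞ ψ := hφ.comp (contDiff_const.sub contDiff_id)
  have hψc : HasCompactSupport ψ := hφc.comp_homeomorph (Homeomorph.subLeft x)
  have hψd : ∀ y, inner ℝ (gradient ψ y) e = -(fderiv ℝ (φ.normed volume) (x - y) e) := fun y => by
    have h1 : HasFDerivAt (fun y => x - y) (-(ContinuousLinearMap.id ℝ _)) y :=
      (hasFDerivAt_id y).const_sub x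
    have h2 := ((hφ.differentiable (by simp) (x - y)).hasFDerivAt).comp y h1
    rw [inner_gradient_left, show ψ = φ.normed volume ∘ fun y => x - y from rfl, h2.fderiv]
    simp
  have i1 : Integrable fun y => f y • gradient ψ y := by
    simpa only [smul_eq_mul] using hf.integrable_smul_right_of_hasCompactSupport
      (continuous_gradient hψs) (hasCompactSupport_gradient hψc)
  have i2 : Integrable fun y => ψ y • g y :=
    hg.integrable_smul_left_of_hasCompactSupport hψs.continuous hψc
  have h1 : ∫ t, (L.flip (f t)) (fderiv ℝ (φ.normed volume) (x - t) e) =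
      inner ℝ e (∫ y, ψ y • g y) := by
    rw [← neg_neg (∫ y, ψ y • g y), ← hfg ψ hψs hψc, inner_neg_right, ← integral_inner i1,
      ← integral_neg]
    refine integral_congr_ae (.of_forall fun y => ?_)
    simp only [hL, ContinuousLinearMap.flip_apply, ContinuousLinearMap.lsmul_apply, smul_eq_mul]
    rw [inner_smul_right, real_inner_comm, hψd]
    ring
  rw [h1]
  have h2 : ‖∫ y, ψ y • g y‖ ≤ M := by
    have hint : Integrable ψ := φ.integrable_normed.comp_sub_left x
    calc ‖∫ y, ψ y • g y‖ ≤ ∫ y, ψ y * M := by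
          refine norm_integral_le_of_norm_le (hint.mul_const _) ?_
          filter_upwards [hgM] with y hy
          rw [norm_smul, Real.norm_of_nonneg (φ.nonneg_normed _)]
          exact mul_le_mul_of_nonneg_left hy (φ.nonneg_normed _)
      _ = M := by
          rw [integral_mul_const, hψ, integral_sub_left_eq_self (φ.normed volume) volume x,
            φ.integral_normed, one_mul]
  calc ‖inner ℝ e (∫ y, ψ y • g y)‖ ≤ ‖e‖ * ‖∫ y, ψ y • g y‖ := norm_inner_le_norm _ _
    _ ≤ ‖e‖ * M := by gcongr
    _ = M * ‖e‖ := mul_comm _ _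

/-- A weakly differentiable function on the whole space with a bounded gradient is Lipschitz, up to
a null set: the mollifications converge almost everywhere. -/
lemma exists_lipschitzWith_ae_eq {f : EuclideanSpace ℝ (Fin N) → ℝ}
    {g : EuclideanSpace ℝ (Fin N) → EuclideanSpace ℝ (Fin N)}
    (hf : LocallyIntegrable f) (hg : LocallyIntegrable g) (hgM : ∀ᵐ x, ‖g x‖ ≤ M)
    (hfg : ∀ φ : EuclideanSpace ℝ (Fin N) → ℝ, ContDiff ℝ ∞ φ → HasCompactSupport φ →
      ∫ x, f x • gradient φ x = - ∫ x, φ x • g x) :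
    ∃ F : EuclideanSpace ℝ (Fin N) → ℝ, LipschitzWith M F ∧ F =ᵐ[volume] f := by
  set φ : ℕ → ContDiffBump (0 : EuclideanSpace ℝ (Fin N)) := fun n =>
    ⟨1 / ((n : ℝ) + 1), 2 * (1 / ((n : ℝ) + 1)), by positivity, by
      have : 0 < 1 / ((n : ℝ) + 1) := by positivity
      linarith⟩ with hφ
  have hlim := ContDiffBump.ae_convolution_tendsto_right_of_locallyIntegrable (φ := φ) (l := atTop)
    (K := 2) (μ := volume)
    (by
      have := (tendsto_one_div_add_atTop_nhds_zero_nat (𝕜 := ℝ)).const_mul 2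
      rwa [mul_zero] at this)
    (.of_forall fun n => le_rfl) hf
  set A := {x | Tendsto (fun n => ((φ n).normed volume
    ⋆[ContinuousLinearMap.lsmul ℝ ℝ, volume] f) x) atTop (𝓝 (f x))} with hA
  have hlip : LipschitzOnWith M f A := by
    refine LipschitzOnWith.of_dist_le_mul fun x hx y hy => ?_
    exact le_of_tendsto' (Tendsto.dist hx hy) fun n =>
      (lipschitzWith_convolution hf hg hgM hfg (φ n)).dist_le_mul x y
  obtain ⟨F, hF, hFA⟩ := hlip.extend_real
  exact ⟨F, hF, by filter_upwards [hlim] with x hx using (hFA hx).symm⟩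

lemma abs_softThreshold_sub_le {ε : ℝ} (s t : ℝ) :
    |(s - max (-ε) (min ε s)) - (t - max (-ε) (min ε t))| ≤ |s - t| := by
  grind

/-- A Lipschitz function vanishing off `Ω` is a uniform limit of test functions on `Ω` with the
same bound on the gradient: move the values towards zero by `ε`, then mollify. -/
lemma exists_isTest_approx (hΩ : IsOpen Ω) (hΩb : Bornology.IsBounded Ω)
    {F : EuclideanSpace ℝ (Fin N) → ℝ} (hF : LipschitzWith M F) (hF0 : ∀ x ∉ Ω, F x = 0)
    {ε : ℝ} (hε : 0 < ε) :
    ∃ ψ, IsTest Ω ψ ∧ (∀ x, ‖gradient ψ x‖ ≤ M) ∧ ∀ x, |ψ x - F x| ≤ 2 * ε := by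
  set T : EuclideanSpace ℝ (Fin N) → ℝ := fun x => F x - max (-ε) (min ε (F x)) with hT
  have hTF : ∀ x, |T x - F x| ≤ ε := fun x => by
    simp only [hT]; grind
  have hTlip : LipschitzWith M T := LipschitzWith.of_dist_le_mul fun x y =>
    (abs_softThreshold_sub_le (F x) (F y)).trans (hF.dist_le_mul x y)
  set C := {x | ε ≤ |F x|} with hC
  have hTC : Function.support T ⊆ C := fun x hx => by
    by_contra hx'
    have h1 : |F x| < ε := not_le.1 hx'
    refine hx ?_
    simp only [hT]; grind
  have hCΩ : C ⊆ Ω := fun x hx => by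
    by_contra hx'
    have : ε ≤ |F x| := hx
    rw [hF0 x hx', abs_zero] at this
    linarith
  have hCc : IsCompact C := Metric.isCompact_of_isClosed_isBounded
    (isClosed_le continuous_const hF.continuous.abs) (hΩb.subset hCΩ)
  obtain ⟨δ, hδ, hδΩ⟩ := hCc.exists_cthickening_subset_open hΩ hCΩ
  set η := min δ (ε / (M + 1)) with hη
  have hη0 : 0 < η := by positivity
  let φ : ContDiffBump (0 : EuclideanSpace ℝ (Fin N)) := ⟨η / 2, η, by positivity, by linarith⟩
  have hφη : φ.rOut = η := rfl
  set ψ := (φ.normed volume ⋆[ContinuousLinearMap.lsmul ℝ ℝ, volume] T :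
    EuclideanSpace ℝ (Fin N) → ℝ) with hψ
  have hTloc : LocallyIntegrable T := hTlip.continuous.locallyIntegrable
  have hψs : ContDiff ℝ ∞ ψ := φ.hasCompactSupport_normed.contDiff_convolution_left _
    φ.contDiff_normed hTloc
  have hsupp : tsupport ψ ⊆ Metric.cthickening δ C := by
    refine closure_minimal ?_ Metric.isClosed_cthickening
    refine (support_convolution_subset _).trans ?_
    rw [φ.support_normed_eq]
    rintro _ ⟨a, ha, b, hb, rfl⟩
    refine Metric.mem_cthickening_of_dist_le _ b δ C (hTC hb) ?_
    rw [mem_ball_zero_iff, hφη] at ha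
    rw [dist_eq_norm, add_sub_cancel_right]
    exact ha.le.trans (min_le_left _ _)
  refine ⟨ψ, ⟨hψs, ?_, hsupp.trans hδΩ⟩, fun x => ?_, fun x => ?_⟩
  · exact hCc.cthickening.of_isClosed_subset (isClosed_tsupport _) hsupp
  · have hψlip : LipschitzWith M ψ := by
      have hi : ∀ x, Integrable fun t => φ.normed volume t • T (x - t) := fun x =>
        (φ.continuous_normed.smul (hTlip.continuous.comp (by fun_prop))
          ).integrable_of_hasCompactSupport φ.hasCompactSupport_normed.smul_right
      refine LipschitzWith.of_dist_le_mul fun x y => ?_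
      rw [dist_eq_norm, hψ, convolution_def, convolution_def]
      simp only [ContinuousLinearMap.lsmul_apply]
      rw [← integral_sub (hi x) (hi y)]
      calc _ ≤ ∫ t, φ.normed volume t * (M * dist x y) := by
            refine norm_integral_le_of_norm_le (φ.integrable_normed.mul_const _)
              (.of_forall fun t => ?_)
            rw [← smul_sub, norm_smul, Real.norm_of_nonneg (φ.nonneg_normed _)]
            refine mul_le_mul_of_nonneg_left ?_ (φ.nonneg_normed _)
            simpa [dist_eq_norm] using hTlip.dist_le_mul (x - t) (y - t)
        _ = M * dist x y := by rw [integral_mul_const, φ.integral_normed, one_mul]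
    rw [gradient, LinearIsometryEquiv.norm_map]
    exact norm_fderiv_le_of_lipschitz ℝ hψlip
  · have h1 : dist (ψ x) (T x) ≤ ε := by
      refine φ.dist_normed_convolution_le hTlip.continuous.aestronglyMeasurable fun y hy => ?_
      refine (hTlip.dist_le_mul y x).trans ?_
      rw [Metric.mem_ball, hφη] at hy
      calc M * dist y x ≤ M * (ε / (M + 1)) := by
            gcongr
            exact hy.le.trans (min_le_right _ _)
        _ ≤ ε := by
            rw [mul_div_assoc', div_le_iff₀ (by positivity)]
            nlinarith [M.2]
    rw [Real.dist_eq] at h1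
    have := abs_sub_le (ψ x) (T x) (F x)
    linarith [hTF x]

/-- Approximation by test functions with bounded gradients and lower semicontinuity give the
membership for all finite exponents; `constraint_of_energy_le` then passes to `∞`. -/
lemma memSobolevZero_top_of_lipschitzWith (hN : 0 < N) (hΩ : IsOpen Ω)
    (hΩb : Bornology.IsBounded Ω) {F : EuclideanSpace ℝ (Fin N) → ℝ} (hF : LipschitzWith M F)
    (hF0 : ∀ x ∉ Ω, F x = 0) : MemSobolevZero Ω ⊤ F := by
  have : IsFiniteMeasure (volume.restrict Ω) := ⟨by simpa using hΩb.measure_lt_top⟩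
  have hvol : volume Ω ≠ ⊤ := hΩb.measure_lt_top.ne
  set B := Metric.closedBall (0 : EuclideanSpace ℝ (Fin N)) (M + 1) with hB
  have hB0 : 0 ∈ interior B := mem_interior_iff_mem_nhds.2 (Metric.closedBall_mem_nhds _
    (by positivity))
  choose ψ hψ hψM hψF using fun n : ℕ => exists_isTest_approx hΩ hΩb hF hF0
    (show 0 < 1 / ((n : ℝ) + 1) by positivity)
  refine (constraint_of_energy_le hN hΩ hΩb (isCompact_closedBall _ _) (convex_closedBall _ _) hB0
    hvol fun r hr => ?_).1
  refine energy_le_of_tendsto (u := ψ) hN hΩ hΩb (isCompact_closedBall _ _) (convex_closedBall _ _)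
    hB0 (fun _ _ => le_rfl) (isConvexIntegrand_zero _) hr hvol (.of_forall fun n => ?_)
    hF.continuous.measurable.aemeasurable ?_
  · have hmem := (hψ n).memSobolevZeroFin (p := ENNReal.ofReal r) (by simpa using hr.le)
    refine (energy_le_of_gauge_le_one hr.le hmem ?_).trans ?_
    · have hw : HasWeakGradient Ω (ψ n) (gradient (ψ n)) := by
        refine ⟨(hψ n).1.continuous.locallyIntegrable.locallyIntegrableOn _,
          (continuous_gradient (hψ n).1).locallyIntegrable.locallyIntegrableOn _, fun φ hφ => ?_⟩
        rw [setIntegral_eq_integral_of_forall_compl_eq_zero,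
          setIntegral_eq_integral_of_forall_compl_eq_zero,
          integral_smul_gradient hφ.1 hφ.2.1 (hψ n).1 (hψ n).2.1]
        · intro x hx; simp [hφ.eq_zero_of_notMem hx]
        · intro x hx; simp [hφ.gradient_eq_zero_of_notMem hx]
      filter_upwards [hw.weakGradient_ae_eq hΩ] with x hx
      rw [hx]
      refine gauge_le_one_of_mem ?_
      rw [mem_closedBall_zero_iff]
      linarith [hψM n x]
    · simp only [ENNReal.ofReal_zero, lintegral_zero, zero_add]
      refine mul_le_of_le_one_left' (ENNReal.ofReal_le_one.2 ?_)
      rw [div_le_one (by linarith)]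
      exact hr.le
  · have h0 : Tendsto (fun n : ℕ => ENNReal.ofReal (2 * (1 / ((n : ℝ) + 1))) * volume Ω) atTop
        (𝓝 0) := by
      have := ENNReal.Tendsto.mul_const (b := volume Ω) (ENNReal.tendsto_ofReal
        ((tendsto_one_div_add_atTop_nhds_zero_nat (𝕜 := ℝ)).const_mul 2)) (Or.inr hvol)
      simpa using this
    refine tendsto_of_tendsto_of_tendsto_of_le_of_le tendsto_const_nhds h0 (fun _ => zero_le)
      fun n => ?_
    calc _ ≤ ∫⁻ _ in Ω, ENNReal.ofReal (2 * (1 / ((n : ℝ) + 1))) :=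
          lintegral_mono fun x => ENNReal.ofReal_le_ofReal (hψF n x)
      _ = _ := by simp

/-- If the complement of `Ω` is thick at the boundary, then functions of `W^{1,1}_0(Ω)` with a
bounded gradient are Lipschitz and vanish on the boundary. -/
lemma memSobolevZero_top_of_thickComplement (hN : 0 < N) (hΩ : IsOpen Ω)
    (hΩb : Bornology.IsBounded Ω) (hthick : ThickComplement Ω) (hv : MemSobolevZeroFin Ω 1 v)
    (hvM : ∀ᵐ x ∂(volume.restrict Ω), ‖weakGradient Ω v x‖ ≤ M) :
    ∃ F, F =ᵐ[volume.restrict Ω] v ∧ MemSobolevZero Ω ⊤ F := by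
  have : IsFiniteMeasure (volume.restrict Ω) := ⟨by simpa using hΩb.measure_lt_top⟩
  obtain ⟨_, w, hw⟩ := hv
  have hgw := weakGradient_ae_eq_of_mem hΩ w.2 hw
  have hm := hΩ.measurableSet
  obtain ⟨F, hF, hFf⟩ := exists_lipschitzWith_ae_eq (M := M) (f := Ω.indicator w.1.1)
    (g := Ω.indicator w.1.2)
    (((integrable_indicator_iff hm).2 ((Lp.memLp w.1.1).integrable le_rfl)).locallyIntegrable)
    (((integrable_indicator_iff hm).2 ((Lp.memLp w.1.2).integrable le_rfl)).locallyIntegrable)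
    (by
      have h1 : ∀ᵐ x ∂(volume.restrict Ω), ‖w.1.2 x‖ ≤ M := by
        filter_upwards [hgw, hvM] with x h1 h2
        rwa [← h1]
      rw [ae_restrict_iff' hm] at h1
      filter_upwards [h1] with x hx
      by_cases hxΩ : x ∈ Ω
      · simpa [hxΩ] using hx hxΩ
      · simp [hxΩ])
    (fun φ hφ hφc => by
      have h1 := integral_smul_gradient_of_mem w.2 hφ hφc
      rw [← integral_indicator hm, ← integral_indicator hm] at h1
      refine Eq.trans ?_ (h1.trans (congrArg _ ?_)) <;>
      · refine integral_congr_ae (.of_forall fun x => ?_)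
        by_cases hx : x ∈ Ω <;> simp [hx])
  have hFv : F =ᵐ[volume.restrict Ω] v := by
    refine EventuallyEq.trans ?_ hw
    rw [EventuallyEq, ae_restrict_iff' hm]
    filter_upwards [hFf] with x hx hxΩ
    rw [hx, indicator_of_mem hxΩ]
  refine ⟨F, hFv, memSobolevZero_top_of_lipschitzWith hN hΩ hΩb hF fun x hx => ?_⟩
  by_contra hFx
  -- near `x` the continuous function `F` is nonzero, but it vanishes almost everywhere off `Ω`
  obtain ⟨ρ, hρ, hball⟩ := Metric.isOpen_iff.1 (isOpen_ne_fun hF.continuous continuous_const) x hFx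
  have hnull : volume (Metric.ball x ρ \ Ω) = 0 := by
    refine measure_mono_null ?_ hFf
    rintro y ⟨hy, hyΩ⟩ h
    have h' : F y = Ω.indicator (w.1.1) y := h
    rw [indicator_of_notMem hyΩ] at h'
    exact hball hy h'
  by_cases hxf : x ∈ frontier Ω
  · exact (hthick x hxf ρ hρ).ne' hnull
  · have hxc : x ∈ (closure Ω)ᶜ := fun hxc => hxf (by rw [hΩ.frontier_eq]; exact ⟨hxc, hx⟩)
    have hopen : IsOpen (Metric.ball x ρ ∩ (closure Ω)ᶜ) :=
      Metric.isOpen_ball.inter isClosed_closure.isOpen_compl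
    refine (hopen.measure_pos volume ⟨x, Metric.mem_ball_self hρ, hxc⟩).ne'
      (measure_mono_null ?_ hnull)
    exact fun y hy => ⟨hy.1, fun hyΩ => hy.2 (subset_closure hyΩ)⟩

end Lipschitz
end SobolevGamma

namespace SobolevGamma

variable {N : ℕ} {Ω K : Set (EuclideanSpace ℝ (Fin N))} {p q : ℝ≥0∞}

/-! ### `Γ`-convergence -/

section GammaConvergence

variable {v : EuclideanSpace ℝ (Fin N) → ℝ} {r s : ℝ}

/-- The functions of `W^{1,∞}_0(Ω)` whose gradient lies in `K` almost everywhere. -/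
def Admissible (Ω K : Set (EuclideanSpace ℝ (Fin N))) (v : EuclideanSpace ℝ (Fin N) → ℝ) : Prop :=
  MemSobolevZero Ω ⊤ v ∧ ∀ᵐ x ∂(volume.restrict Ω), weakGradient Ω v x ∈ K

lemma Admissible.memSobolevZeroFin (h : Admissible Ω K v) (hp : 1 ≤ p) (hp' : p ≠ ⊤) :
    MemSobolevZeroFin Ω p v := by
  have h1 := h.1
  rw [MemSobolevZero, if_pos rfl] at h1
  exact h1.2 p hp hp'

lemma MemSobolevZero.top_congr_ae (hΩ : IsOpen Ω) {v' : EuclideanSpace ℝ (Fin N) → ℝ}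
    (h : MemSobolevZero Ω ⊤ v) (hv : v =ᵐ[volume.restrict Ω] v') : MemSobolevZero Ω ⊤ v' := by
  rw [MemSobolevZero, if_pos rfl] at h ⊢
  obtain ⟨⟨h1, g, hg, hvg⟩, h2⟩ := h
  exact ⟨⟨h1.ae_eq hv, g, hg, hvg.congr_ae hΩ hv⟩, fun q hq hq' => (h2 q hq hq').congr_ae hv⟩

lemma admissible_zero (hN : 0 < N) (hΩ : IsOpen Ω) (hΩb : Bornology.IsBounded Ω)
    (hK0 : 0 ∈ interior K) (hv : v =ᵐ[volume.restrict Ω] 0) : Admissible Ω K v := by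
  have hw : HasWeakGradient Ω (0 : EuclideanSpace ℝ (Fin N) → ℝ) 0 :=
    ⟨locallyIntegrable_zero.locallyIntegrableOn _, locallyIntegrable_zero.locallyIntegrableOn _,
      fun φ _ => by simp⟩
  refine ⟨(memSobolevZero_top_of_lipschitzWith (M := 0) hN hΩ hΩb
    (LipschitzWith.const (0 : ℝ)) fun _ _ => rfl).top_congr_ae hΩ hv.symm, ?_⟩
  filter_upwards [(hw.congr_ae hΩ hv.symm).weakGradient_ae_eq hΩ] with x hx
  rw [hx]
  exact interior_subset hK0

lemma Admissible.energy_le [IsFiniteMeasure (volume.restrict Ω)] (h : Admissible Ω K v)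
    {ℓ : EuclideanSpace ℝ (Fin N) → ℝ → ℝ} (hr : 1 ≤ r) :
    energy Ω K ℓ r v ≤
      (∫⁻ x in Ω, ENNReal.ofReal (ℓ x (v x))) + ENNReal.ofReal (1 / r) * volume Ω := by
  refine energy_le_of_gauge_le_one hr (h.memSobolevZeroFin (by simpa using hr) (by simp)) ?_
  filter_upwards [h.2] with x hx using gauge_le_one_of_mem hx

lemma tendsto_ofReal_one_div_mul {c : ℝ≥0∞} (hc : c ≠ ⊤) :
    Tendsto (fun r : ℝ => ENNReal.ofReal (1 / r) * c) atTop (𝓝 0) := by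
  have h : Tendsto (fun r : ℝ => 1 / r) atTop (𝓝 0) := by
    simpa using tendsto_inv_atTop_zero (𝕜 := ℝ)
  simpa using ENNReal.Tendsto.mul_const (b := c) (ENNReal.tendsto_ofReal h) (Or.inr hc)

lemma Admissible.limsup_energy_le (hΩb : Bornology.IsBounded Ω) (h : Admissible Ω K v)
    (ℓ : EuclideanSpace ℝ (Fin N) → ℝ → ℝ) :
    limsup (fun r => energy Ω K ℓ r v) atTop ≤ ∫⁻ x in Ω, ENNReal.ofReal (ℓ x (v x)) := by
  have : IsFiniteMeasure (volume.restrict Ω) := ⟨by simpa using hΩb.measure_lt_top⟩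
  have hlim := (tendsto_ofReal_one_div_mul hΩb.measure_lt_top.ne (c := volume Ω)).const_add
    (∫⁻ x in Ω, ENNReal.ofReal (ℓ x (v x)))
  rw [add_zero] at hlim
  rw [← hlim.limsup_eq]
  refine limsup_le_limsup ?_
  filter_upwards [eventually_ge_atTop 1] with r hr using h.energy_le hr

lemma tendsto_lintegral_abs_sub [IsFiniteMeasure (volume.restrict Ω)] [Fact (1 ≤ q)]
    {w : ℕ → Lp ℝ q (volume.restrict Ω)} {v : Lp ℝ q (volume.restrict Ω)}
    (hw : Tendsto w atTop (𝓝 v)) :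
    Tendsto (fun n => ∫⁻ x in Ω, ENNReal.ofReal |w n x - v x|) atTop (𝓝 0) := by
  have h1 := tendsto_iff_edist_tendsto_0.1 hw
  simp only [Lp.edist_def] at h1
  have h2 := tendsto_eLpNorm_of_exponent_le (Fact.out : 1 ≤ q)
    (fun n => (Lp.memLp (w n)).1.sub (Lp.memLp v).1) h1
  simpa only [eLpNorm_one_eq_lintegral_enorm, Real.enorm_eq_ofReal_abs, Pi.sub_apply] using h2

lemma energy_zero_le {ℓ : EuclideanSpace ℝ (Fin N) → ℝ → ℝ} (hℓ : ∀ x s, 0 ≤ ℓ x s) :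
    energy Ω K (fun _ _ => 0) r v ≤ energy Ω K ℓ r v := by
  by_cases h : MemSobolevZeroFin Ω (ENNReal.ofReal r) v
  · rw [energy_of_mem h, energy_of_mem h]
    exact lintegral_mono fun x => ENNReal.ofReal_le_ofReal (by simpa using hℓ x (v x))
  · rw [energy.eq_def Ω K ℓ, if_neg h]; exact le_top

/-- The compactness half of the `Γ`-liminf inequality. -/
lemma admissible_of_liminf_ne_top (hN : 0 < N) (hΩ : IsOpen Ω) (hΩb : Bornology.IsBounded Ω)
    (hK : IsCompact K) (hKc : Convex ℝ K) (hK0 : 0 ∈ interior K) [Fact (1 ≤ q)]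
    {ℓ : EuclideanSpace ℝ (Fin N) → ℝ → ℝ} (hℓ : ∀ x s, 0 ≤ ℓ x s)
    {w : ℝ → Lp ℝ q (volume.restrict Ω)} {v : Lp ℝ q (volume.restrict Ω)}
    (hw : Tendsto w atTop (𝓝 v)) (h : liminf (fun r => energy Ω K ℓ r (w r)) atTop ≠ ⊤) :
    Admissible Ω K v := by
  have : IsFiniteMeasure (volume.restrict Ω) := ⟨by simpa using hΩb.measure_lt_top⟩
  obtain ⟨c, hc1, hc2⟩ := exists_between (lt_top_iff_ne_top.2 h)
  obtain ⟨e, he, hec⟩ := exists_seq_forall_of_frequently (frequently_lt_of_liminf_lt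
    (by isBoundedDefault) hc1)
  exact constraint_of_tendsto hN hΩ hΩb hK hKc hK0 hc2.ne he
    (fun n => (energy_zero_le hℓ).trans (hec n).le) (Lp.memLp v).1.aemeasurable
    (tendsto_lintegral_abs_sub (hw.comp he))

theorem gammaTendsto_powerEnergy (hN : 0 < N) (hΩ : IsOpen Ω) (hΩb : Bornology.IsBounded Ω)
    (hK : IsCompact K) (hKc : Convex ℝ K) (hK0 : 0 ∈ interior K) [Fact (1 ≤ q)] :
    GammaTendsto atTop
      (fun (r : ℝ) (v : Lp ℝ q (volume.restrict Ω)) => powerEnergy Ω K r v)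
      (fun v : Lp ℝ q (volume.restrict Ω) => constraintEnergy Ω K v) := by
  simp only [powerEnergy_eq_energy]
  refine ⟨fun v => ⟨fun _ => v, tendsto_const_nhds, ?_⟩, fun v w hw => ?_⟩
  · by_cases h : Admissible Ω K v
    · refine (h.limsup_energy_le hΩb _).trans ?_
      simp
    · exact le_top.trans_eq (if_neg h).symm
  · by_cases h : liminf (fun r => energy Ω K (fun _ _ => 0) r (w r)) atTop = ⊤
    · rw [h]; exact le_top
    · refine le_of_eq_of_le (if_pos ?_) zero_le
      exact admissible_of_liminf_ne_top hN hΩ hΩb hK hKc hK0 (fun _ _ => le_rfl) hw h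

lemma Admissible.constraintFidelity_eq (hv : Admissible Ω K v)
    (ubar : EuclideanSpace ℝ (Fin N) → ℝ) {s : ℝ≥0∞} (hs : s = ⊤ ∨ s = 1) :
    constraintFidelity Ω K ubar s v = ∫⁻ x in Ω, ENNReal.ofReal ((v x - ubar x) ^ 2) := by
  have hm : MemSobolevZero Ω s v := by
    rcases hs with rfl | rfl
    · exact hv.1
    · rw [MemSobolevZero, if_neg ENNReal.one_ne_top]
      exact hv.memSobolevZeroFin le_rfl ENNReal.one_ne_top
  rw [constraintFidelity, if_pos hm]
  refine lintegral_congr_ae ?_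
  filter_upwards [hv.2] with x hx
  rw [indicatorFun, if_pos hx, zero_add]

/-- The domain of `J` consists of admissible functions. For `s = 1` this is where the thickness of
the complement enters. -/
lemma admissible_of_constraintFidelity_ne_top (hN : 0 < N) (hΩ : IsOpen Ω)
    (hΩb : Bornology.IsBounded Ω) (hK : IsCompact K) {ubar : EuclideanSpace ℝ (Fin N) → ℝ}
    (hu : AEMeasurable ubar (volume.restrict Ω)) {s : ℝ≥0∞} (hs : s = ⊤ ∨ (s = 1 ∧ ThickComplement Ω))
    (h : constraintFidelity Ω K ubar s v ≠ ⊤) : Admissible Ω K v := by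
  have : IsFiniteMeasure (volume.restrict Ω) := ⟨by simpa using hΩb.measure_lt_top⟩
  have hm : MemSobolevZero Ω s v := by
    by_contra hv
    exact h (if_neg hv)
  rw [constraintFidelity, if_pos hm] at h
  have h1 : MemSobolevZeroFin Ω 1 v := by
    rcases hs with rfl | ⟨rfl, -⟩
    · rw [MemSobolevZero, if_pos rfl] at hm
      exact hm.2 1 le_rfl ENNReal.one_ne_top
    · rwa [MemSobolevZero, if_neg ENNReal.one_ne_top] at hm
  have hgK : ∀ᵐ x ∂(volume.restrict Ω), weakGradient Ω v x ∈ K := by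
    obtain ⟨_, w, hw⟩ := h1
    have hgm : AEMeasurable (weakGradient Ω v) (volume.restrict Ω) :=
      ((Lp.memLp w.1.2).1.congr (weakGradient_ae_eq_of_mem hΩ w.2 hw).symm).aemeasurable
    have hvm : AEMeasurable v (volume.restrict Ω) :=
      ((Lp.memLp w.1.1).1.congr hw).aemeasurable
    have hind : Measurable (indicatorFun K) :=
      Measurable.ite hK.measurableSet measurable_const measurable_const
    filter_upwards [ae_lt_top' ((hind.comp_aemeasurable hgm).add
      ((hvm.sub hu).pow_const 2).ennreal_ofReal) h] with x hx
    by_contra hxK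
    simp [indicatorFun, hxK] at hx
  refine ⟨?_, hgK⟩
  rcases hs with rfl | ⟨rfl, ht⟩
  · exact hm
  · obtain ⟨R, hR, hKR⟩ := hK.isBounded.subset_closedBall_lt 0 0
    obtain ⟨F, hF, hFm⟩ := memSobolevZero_top_of_thickComplement (M := ⟨R, hR.le⟩) hN hΩ hΩb ht h1
      (by filter_upwards [hgK] with x hx using mem_closedBall_zero_iff.1 (hKR hx))
    exact hFm.top_congr_ae hΩ hF

lemma lintegral_sub_sq {α : Type*} [MeasurableSpace α] {μ : Measure α} (f g : Lp ℝ 2 μ) :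
    ∫⁻ x, ENNReal.ofReal ((f x - g x) ^ 2) ∂μ = ENNReal.ofReal (‖f - g‖ ^ 2) := by
  rw [← real_inner_self_eq_norm_sq, L2.inner_def, ofReal_integral_eq_lintegral_ofReal
    (L2.integrable_inner _ _) (.of_forall fun x => real_inner_self_nonneg)]
  refine lintegral_congr_ae ?_
  filter_upwards [Lp.coeFn_sub f g] with x hx
  rw [hx, real_inner_self_eq_norm_sq, Real.norm_eq_abs, sq_abs, Pi.sub_apply]

variable {ubar : Lp ℝ 2 (volume.restrict Ω)} {s : ℝ≥0∞}

/-- The `Γ`-liminf inequality for `J_p`. -/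
lemma constraintFidelity_le_liminf (hN : 0 < N) (hΩ : IsOpen Ω) (hΩb : Bornology.IsBounded Ω)
    (hK : IsCompact K) (hKc : Convex ℝ K) (hK0 : 0 ∈ interior K) (hs : s = ⊤ ∨ s = 1)
    {w : ℝ → Lp ℝ 2 (volume.restrict Ω)} {v : Lp ℝ 2 (volume.restrict Ω)}
    (hw : Tendsto w atTop (𝓝 v)) :
    constraintFidelity Ω K ubar s v ≤ liminf (fun r => powerFidelity Ω K ubar r (w r)) atTop := by
  simp only [powerFidelity_eq_energy]
  by_cases h : liminf (fun r => energy Ω K (fun x s => (s - ubar x) ^ 2) r (w r)) atTop = ⊤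
  · rw [h]; exact le_top
  have hv := admissible_of_liminf_ne_top hN hΩ hΩb hK hKc hK0 (fun _ _ => sq_nonneg _) hw h
  have hlim : Tendsto (fun r => ENNReal.ofReal (‖w r - ubar‖ ^ 2)) atTop
      (𝓝 (ENNReal.ofReal (‖v - ubar‖ ^ 2))) :=
    ENNReal.tendsto_ofReal (((hw.sub_const ubar).norm).pow 2)
  rw [hv.constraintFidelity_eq _ hs, lintegral_sub_sq, ← hlim.liminf_eq]
  refine liminf_le_liminf ?_
  filter_upwards [eventually_gt_atTop 0] with r hr
  rw [← lintegral_sub_sq]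
  exact lintegral_le_energy hr (ℓ := fun x s => (s - ubar x) ^ 2)

theorem gammaTendsto_powerFidelity (hN : 0 < N) (hΩ : IsOpen Ω) (hΩb : Bornology.IsBounded Ω)
    (hK : IsCompact K) (hKc : Convex ℝ K) (hK0 : 0 ∈ interior K)
    (hs : s = ⊤ ∨ (s = 1 ∧ ThickComplement Ω)) :
    GammaTendsto atTop
      (fun (r : ℝ) (v : Lp ℝ 2 (volume.restrict Ω)) => powerFidelity Ω K ubar r v)
      (fun v : Lp ℝ 2 (volume.restrict Ω) => constraintFidelity Ω K ubar s v) := by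
  have hs' : s = ⊤ ∨ s = 1 := hs.imp_right And.left
  refine ⟨fun v => ⟨fun _ => v, tendsto_const_nhds, ?_⟩, fun v w hw =>
    constraintFidelity_le_liminf hN hΩ hΩb hK hKc hK0 hs' hw⟩
  by_cases h : constraintFidelity Ω K ubar s v = ⊤
  · exact le_top.trans_eq h.symm
  · have hv := admissible_of_constraintFidelity_ne_top hN hΩ hΩb hK
      (Lp.memLp ubar).1.aemeasurable hs h
    simp only [powerFidelity_eq_energy]
    rw [hv.constraintFidelity_eq _ hs']
    exact hv.limsup_energy_le hΩb fun x s => (s - ubar x) ^ 2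

end GammaConvergence
end SobolevGamma

namespace SobolevGamma

variable {N : ℕ} {Ω K : Set (EuclideanSpace ℝ (Fin N))} {p q : ℝ≥0∞}

/-! ### Minimizers of `J_p` and their limit -/

section Minimizers

variable {r : ℝ} {s : ℝ≥0∞} {ubar : Lp ℝ 2 (volume.restrict Ω)}

lemma two_mul_ofReal_midpoint_add_le {A B C a b c : ℝ} (hA : 0 ≤ A) (hB : 0 ≤ B) (hC : 0 ≤ C)
    (h : C ≤ 1 / 2 * A + 1 / 2 * B) :
    2 * ENNReal.ofReal (C + (1 / 2 * a + 1 / 2 * b - c) ^ 2) +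
      ENNReal.ofReal (1 / 2 * (a - b) ^ 2) ≤
      ENNReal.ofReal (A + (a - c) ^ 2) + ENNReal.ofReal (B + (b - c) ^ 2) := by
  rw [show (2 : ℝ≥0∞) = ENNReal.ofReal 2 by simp, ← ENNReal.ofReal_mul (by norm_num),
    ← ENNReal.ofReal_add (by positivity) (by positivity),
    ← ENNReal.ofReal_add (by positivity) (by positivity)]
  exact ENNReal.ofReal_le_ofReal (by linarith)

/-- The midpoint estimate for `J_r`, for pairs `(v, Dv)` in the Sobolev space. -/
lemma two_mul_lagrangian_midpoint_add_le (hKc : Convex ℝ K) (hK0 : 0 ∈ interior K) (hr : 1 ≤ r)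
    [Fact (1 ≤ p)] (a b : sobolevZero Ω p) :
    2 * lagrangian (fun x s ξ => 1 / r * gauge K ξ ^ r + (s - ubar x) ^ 2)
        ((1 / 2 : ℝ) • a + (1 / 2 : ℝ) • b) +
      ∫⁻ x in Ω, ENNReal.ofReal (1 / 2 * (a.1.1 x - b.1.1 x) ^ 2) ≤
      lagrangian (fun x s ξ => 1 / r * gauge K ξ ^ r + (s - ubar x) ^ 2) a +
        lagrangian (fun x s ξ => 1 / r * gauge K ξ ^ r + (s - ubar x) ^ 2) b := by
  have hG := isConvexIntegrand_gauge (volume.restrict Ω) hKc hK0 hr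
  have hI := hG.add (isConvexIntegrand_sq (Lp.memLp ubar).1.aemeasurable)
  obtain ⟨c, hc⟩ : ∃ c : sobolevZero Ω p, c = (1 / 2 : ℝ) • a + (1 / 2 : ℝ) • b := ⟨_, rfl⟩
  have a1 := Lp_coeFn_smul_add_smul (1 / 2) (1 / 2) a.1.1 b.1.1
  have a2 := Lp_coeFn_smul_add_smul (1 / 2) (1 / 2) a.1.2 b.1.2
  rw [show (1 / 2 : ℝ) • a.1.1 + (1 / 2 : ℝ) • b.1.1 = c.1.1 by rw [hc]; rfl] at a1
  rw [show (1 / 2 : ℝ) • a.1.2 + (1 / 2 : ℝ) • b.1.2 = c.1.2 by rw [hc]; rfl] at a2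
  rw [← hc]
  have hm : ∀ z : sobolevZero Ω p, AEMeasurable (fun x => ENNReal.ofReal
      (1 / r * gauge K (z.1.2 x) ^ r + (z.1.1 x - ubar x) ^ 2)) (volume.restrict Ω) :=
    fun z => hI.aemeasurable z
  calc _ = ∫⁻ x in Ω, (2 * ENNReal.ofReal (1 / r * gauge K (c.1.2 x) ^ r +
          (c.1.1 x - ubar x) ^ 2) + ENNReal.ofReal (1 / 2 * (a.1.1 x - b.1.1 x) ^ 2)) := by
        rw [lintegral_add_left' ((hm c).const_mul _), lintegral_const_mul'' _ (hm c)]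
        rfl
    _ ≤ ∫⁻ x in Ω, (ENNReal.ofReal (1 / r * gauge K (a.1.2 x) ^ r + (a.1.1 x - ubar x) ^ 2) +
          ENNReal.ofReal (1 / r * gauge K (b.1.2 x) ^ r + (b.1.1 x - ubar x) ^ 2)) := ?_
    _ = _ := lintegral_add_left' (hm a) _
  refine lintegral_mono_ae ?_
  filter_upwards [a1, a2] with x h1 h2
  have hg := (hG.convex x).2 (mem_univ (a.1.1 x, a.1.2 x)) (mem_univ (b.1.1 x, b.1.2 x))
    (by norm_num : (0 : ℝ) ≤ 1 / 2) (by norm_num : (0 : ℝ) ≤ 1 / 2) (by norm_num)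
  simp only [Prod.smul_mk, Prod.mk_add_mk, smul_eq_mul] at hg
  have hnn : ∀ ξ, 0 ≤ 1 / r * gauge K ξ ^ r := fun ξ => by
    have := gauge_nonneg (s := K) ξ
    positivity
  rw [h1, h2]
  exact two_mul_ofReal_midpoint_add_le (hnn _) (hnn _) (hnn _) hg

set_option maxHeartbeats 1000000 in
/-- Midpoint convexity of `J_r`, with the gain due to the quadratic term. -/
lemma two_mul_powerFidelity_midpoint_add_le (hΩ : IsOpen Ω) (hΩb : Bornology.IsBounded Ω)
    (hKc : Convex ℝ K) (hK0 : 0 ∈ interior K) (hr : 1 ≤ r) (u v : Lp ℝ 2 (volume.restrict Ω)) :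
    2 * powerFidelity Ω K ubar r ((1 / 2 : ℝ) • u + (1 / 2 : ℝ) • v : Lp ℝ 2 (volume.restrict Ω)) +
      ENNReal.ofReal (‖u - v‖ ^ 2 / 2) ≤
      powerFidelity Ω K ubar r u + powerFidelity Ω K ubar r v := by
  have : IsFiniteMeasure (volume.restrict Ω) := ⟨by simpa using hΩb.measure_lt_top⟩
  have : Fact (1 ≤ ENNReal.ofReal r) := ⟨by simpa using hr⟩
  simp only [powerFidelity_eq_energy]
  by_cases hu : energy Ω K (fun x s => (s - ubar x) ^ 2) r u = ⊤
  · rw [hu, top_add]; exact le_top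
  by_cases hv : energy Ω K (fun x s => (s - ubar x) ^ 2) r v = ⊤
  · rw [hv, add_top]; exact le_top
  obtain ⟨a, hau, ha⟩ := exists_lagrangian_eq_energy hΩ hu
  obtain ⟨b, hbv, hb⟩ := exists_lagrangian_eq_energy hΩ hv
  have hcw : ((1 / 2 : ℝ) • a + (1 / 2 : ℝ) • b).1.1 =ᵐ[volume.restrict Ω]
      ((1 / 2 : ℝ) • u + (1 / 2 : ℝ) • v : Lp ℝ 2 (volume.restrict Ω)) := by
    refine (Lp_coeFn_smul_add_smul (1 / 2) (1 / 2) a.1.1 b.1.1).trans ?_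
    filter_upwards [Lp_coeFn_smul_add_smul (1 / 2) (1 / 2) u v, hau, hbv] with x h2 h3 h4
    rw [h2, h3, h4]
  have hdiff : ENNReal.ofReal (‖u - v‖ ^ 2 / 2) =
      ∫⁻ x in Ω, ENNReal.ofReal (1 / 2 * (a.1.1 x - b.1.1 x) ^ 2) := by
    rw [div_eq_inv_mul, ENNReal.ofReal_mul (by norm_num), ← lintegral_sub_sq,
      ← lintegral_const_mul' _ _ ENNReal.ofReal_ne_top]
    refine lintegral_congr_ae ?_
    filter_upwards [hau, hbv] with x h1 h2
    rw [← ENNReal.ofReal_mul (by norm_num), h1, h2, one_div]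
  rw [energy_eq_lagrangian hΩ hcw, hdiff, ← ha, ← hb]
  exact two_mul_lagrangian_midpoint_add_le hKc hK0 hr a b

lemma powerFidelity_zero_le (hN : 0 < N) (hΩ : IsOpen Ω) (hΩb : Bornology.IsBounded Ω)
    (hK0 : 0 ∈ interior K) (hr : 1 ≤ r) :
    powerFidelity Ω K ubar r (0 : Lp ℝ 2 (volume.restrict Ω)) ≤
      ENNReal.ofReal (‖ubar‖ ^ 2) + ENNReal.ofReal (1 / r) * volume Ω := by
  have : IsFiniteMeasure (volume.restrict Ω) := ⟨by simpa using hΩb.measure_lt_top⟩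
  rw [powerFidelity_eq_energy]
  refine ((admissible_zero hN hΩ hΩb hK0 (Lp.coeFn_zero _ _ _)).energy_le hr).trans_eq ?_
  rw [lintegral_sub_sq, zero_sub, norm_neg]

lemma IsMinimizer.powerFidelity_ne_top (hN : 0 < N) (hΩ : IsOpen Ω) (hΩb : Bornology.IsBounded Ω)
    (hK0 : 0 ∈ interior K) (hr : 1 ≤ r) {u : Lp ℝ 2 (volume.restrict Ω)}
    (hu : IsMinimizer (fun w : Lp ℝ 2 (volume.restrict Ω) => powerFidelity Ω K ubar r w) u) :
    powerFidelity Ω K ubar r u ≠ ⊤ :=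
  ne_top_of_le_ne_top (ENNReal.add_ne_top.2 ⟨ENNReal.ofReal_ne_top,
    ENNReal.mul_ne_top ENNReal.ofReal_ne_top hΩb.measure_lt_top.ne⟩)
    ((hu 0).trans (powerFidelity_zero_le hN hΩ hΩb hK0 hr))

/-- The energy gap controls the distance to the minimizer. -/
lemma IsMinimizer.powerFidelity_add_le (hN : 0 < N) (hΩ : IsOpen Ω) (hΩb : Bornology.IsBounded Ω)
    (hKc : Convex ℝ K) (hK0 : 0 ∈ interior K) (hr : 1 ≤ r) {u : Lp ℝ 2 (volume.restrict Ω)}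
    (hu : IsMinimizer (fun w : Lp ℝ 2 (volume.restrict Ω) => powerFidelity Ω K ubar r w) u)
    (v : Lp ℝ 2 (volume.restrict Ω)) :
    powerFidelity Ω K ubar r u + ENNReal.ofReal (‖u - v‖ ^ 2 / 2) ≤
      powerFidelity Ω K ubar r v := by
  have h1 := two_mul_powerFidelity_midpoint_add_le (ubar := ubar) hΩ hΩb hKc hK0 hr u v
  have h2 := hu ((1 / 2 : ℝ) • u + (1 / 2 : ℝ) • v)
  have h3 := hu.powerFidelity_ne_top hN hΩ hΩb hK0 hr
  refine (ENNReal.add_le_add_iff_left h3).1 (le_trans ?_ h1)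
  rw [← add_assoc, ← two_mul]
  gcongr

/-- A weak limit point of a minimizing sequence in `W^{1,r}_0(Ω)` is a minimizer; the minimizer is
unique by the energy gap estimate. -/
theorem existsUnique_isMinimizer_powerFidelity (hN : 0 < N) (hΩ : IsOpen Ω)
    (hΩb : Bornology.IsBounded Ω) (hK : IsCompact K) (hKc : Convex ℝ K) (hK0 : 0 ∈ interior K)
    (hr : 1 < r) : ∃! v : Lp ℝ 2 (volume.restrict Ω),
      IsMinimizer (fun w : Lp ℝ 2 (volume.restrict Ω) => powerFidelity Ω K ubar r w) v := by
  have : IsFiniteMeasure (volume.restrict Ω) := ⟨by simpa using hΩb.measure_lt_top⟩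
  have : Fact (1 ≤ ENNReal.ofReal r) := ⟨by simpa using hr.le⟩
  refine existsUnique_of_exists_of_unique ?_ fun u v hu hv => ?_
  · set m : ℝ≥0∞ := ⨅ v : Lp ℝ 2 (volume.restrict Ω), powerFidelity Ω K ubar r v with hm
    have hmt : m ≠ ⊤ := ne_top_of_le_ne_top (ENNReal.add_ne_top.2 ⟨ENNReal.ofReal_ne_top,
      ENNReal.mul_ne_top ENNReal.ofReal_ne_top hΩb.measure_lt_top.ne⟩)
      ((iInf_le _ 0).trans (powerFidelity_zero_le hN hΩ hΩb hK0 hr.le))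
    set h : EuclideanSpace ℝ (Fin N) → ℝ → EuclideanSpace ℝ (Fin N) → ℝ :=
      fun x s ξ => 1 / r * gauge K ξ ^ r + (s - ubar x) ^ 2 with hh
    have hI : IsConvexIntegrand (volume.restrict Ω) h :=
      (isConvexIntegrand_gauge (volume.restrict Ω) hKc hK0 hr.le).add
        (isConvexIntegrand_sq (Lp.memLp ubar).1.aemeasurable)
    have hex : ∀ n : ℕ, ∃ w : sobolevZero Ω (ENNReal.ofReal r),
        lagrangian h w ≤ m + ((n : ℝ≥0∞) + 1)⁻¹ := fun n => by
      obtain ⟨v, hv⟩ := iInf_lt_iff.1 (ENNReal.lt_add_right hmt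
        (show ((n : ℝ≥0∞) + 1)⁻¹ ≠ 0 by simp))
      rw [powerFidelity_eq_energy] at hv
      obtain ⟨w, -, hw⟩ := exists_lagrangian_eq_energy hΩ hv.ne_top
      exact ⟨w, hw.trans_le hv.le⟩
    choose w hw using hex
    have hw1 : ∀ n, lagrangian h (w n) ≤ m + 1 := fun n => (hw n).trans (by
      gcongr
      exact ENNReal.inv_le_one.2 (by simp))
    obtain ⟨y, hy⟩ := exists_weak_limit hN hΩ hΩb hK hK0 (ℓ := fun x s => (s - ubar x) ^ 2)
      (fun _ _ => sq_nonneg _) hr (ENNReal.add_ne_top.2 ⟨hmt, ENNReal.one_ne_top⟩) hw1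
    have hym : lagrangian h y ≤ m := by
      have hlim : Tendsto (fun n : ℕ => m + ((n : ℝ≥0∞) + 1)⁻¹) atTop (𝓝 m) := by
        have h1 : Tendsto (fun n : ℕ => ((n : ℝ≥0∞) + 1)⁻¹) atTop (𝓝 0) := by
          have := (tendsto_add_atTop_iff_nat 1).2 ENNReal.tendsto_inv_nat_nhds_zero
          simpa using this
        simpa using h1.const_add m
      refine ge_of_tendsto' hlim fun n => ?_
      refine hy _ (hI.convex_sublevel _) (hI.isClosed_sublevel _) ?_
      filter_upwards [eventually_ge_atTop n] with k hk
      refine (hw k).trans ?_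
      gcongr
    have hy2 : MemLp y.1.1 2 (volume.restrict Ω) := by
      have h1 : AEStronglyMeasurable (fun x => y.1.1 x - ubar x) (volume.restrict Ω) :=
        (Lp.memLp y.1.1).1.sub (Lp.memLp ubar).1
      have h2 : Integrable (fun x => (y.1.1 x - ubar x) ^ 2) (volume.restrict Ω) := by
        refine ⟨h1.pow 2, ?_⟩
        rw [hasFiniteIntegral_iff_ofReal (.of_forall fun x => sq_nonneg _)]
        refine lt_of_le_of_lt ?_ (lt_of_le_of_lt hym hmt.lt_top)
        refine lintegral_mono fun x => ENNReal.ofReal_le_ofReal ?_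
        have := gauge_nonneg (s := K) (y.1.2 x)
        simp only [hh, le_add_iff_nonneg_left]
        positivity
      have h3 := ((memLp_two_iff_integrable_sq h1).2 h2).add (Lp.memLp ubar)
      refine h3.ae_eq (.of_forall fun x => ?_)
      simp
    refine ⟨hy2.toLp, fun v => ?_⟩
    change powerFidelity Ω K ubar r (hy2.toLp _) ≤ powerFidelity Ω K ubar r v
    rw [powerFidelity_eq_energy, energy_eq_lagrangian hΩ hy2.coeFn_toLp.symm]
    exact hym.trans (iInf_le _ v)
  · have h1 := hu.powerFidelity_add_le hN hΩ hΩb hKc hK0 hr.le v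
    have h2 := hv u
    have h3 := hv.powerFidelity_ne_top hN hΩ hΩb hK0 hr.le
    have h4 : ENNReal.ofReal (‖u - v‖ ^ 2 / 2) = 0 := by
      refine le_antisymm ?_ zero_le
      refine (ENNReal.add_le_add_iff_left h3).1 ?_
      rw [add_zero]
      exact (add_le_add_left h2 _).trans h1
    rw [ENNReal.ofReal_eq_zero] at h4
    have h5 : ‖u - v‖ = 0 := by nlinarith [norm_nonneg (u - v)]
    exact sub_eq_zero.1 (norm_eq_zero.1 h5)

lemma powerFidelity_le_add (hΩb : Bornology.IsBounded Ω) {r' : ℝ} (hr : 1 ≤ r) (hrr' : r ≤ r')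
    (v : Lp ℝ 2 (volume.restrict Ω)) :
    powerFidelity Ω K ubar r v ≤
      powerFidelity Ω K ubar r' v + ENNReal.ofReal (1 / r - 1 / r') * volume Ω := by
  have : IsFiniteMeasure (volume.restrict Ω) := ⟨by simpa using hΩb.measure_lt_top⟩
  rw [powerFidelity_eq_energy, powerFidelity_eq_energy]
  exact energy_le_energy_add hr hrr'

/-- `J` has a minimizer, and the minimizers of `J_p` converge in `L^2(Ω)` to each minimizer of `J`,
which is therefore unique. Since `p ↦ min J_p - |Ω| / p` is nondecreasing and bounded, the energy
gap estimate makes the minimizers of `J_p` a Cauchy family. -/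
theorem exists_isMinimizer_constraintFidelity (hN : 0 < N) (hΩ : IsOpen Ω)
    (hΩb : Bornology.IsBounded Ω) (hK : IsCompact K) (hKc : Convex ℝ K) (hK0 : 0 ∈ interior K)
    (hs : s = ⊤ ∨ (s = 1 ∧ ThickComplement Ω)) {u : ℝ → Lp ℝ 2 (volume.restrict Ω)}
    (hu : ∀ r, 1 < r → IsMinimizer
      (fun w : Lp ℝ 2 (volume.restrict Ω) => powerFidelity Ω K ubar r w) (u r)) :
    ∃ u₀, IsMinimizer
        (fun w : Lp ℝ 2 (volume.restrict Ω) => constraintFidelity Ω K ubar s w) u₀ ∧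
      ∀ v, IsMinimizer
        (fun w : Lp ℝ 2 (volume.restrict Ω) => constraintFidelity Ω K ubar s w) v →
        Tendsto u atTop (𝓝 v) := by
  have : IsFiniteMeasure (volume.restrict Ω) := ⟨by simpa using hΩb.measure_lt_top⟩
  have hs' : s = ⊤ ∨ s = 1 := hs.imp_right And.left
  set V : ℝ := (volume Ω).toReal with hV
  have hVe : volume Ω = ENNReal.ofReal V := (ENNReal.ofReal_toReal hΩb.measure_lt_top.ne).symm
  have hV0 : 0 ≤ V := ENNReal.toReal_nonneg
  set A : ℝ → ℝ := fun r => (powerFidelity Ω K ubar r (u r)).toReal with hA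
  have hA0 : ∀ r, 0 ≤ A r := fun r => ENNReal.toReal_nonneg
  have hAe : ∀ r, 1 < r → powerFidelity Ω K ubar r (u r) = ENNReal.ofReal (A r) := fun r hr =>
    (ENNReal.ofReal_toReal ((hu r hr).powerFidelity_ne_top hN hΩ hΩb hK0 hr.le)).symm
  -- the gap estimate in real numbers
  have hgap : ∀ r, 1 < r → ∀ v : Lp ℝ 2 (volume.restrict Ω), ∀ t : ℝ, 0 ≤ t →
      powerFidelity Ω K ubar r v ≤ ENNReal.ofReal t → A r + ‖u r - v‖ ^ 2 / 2 ≤ t :=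
    fun r hr v t ht hvt => by
      have h1 := ((hu r hr).powerFidelity_add_le hN hΩ hΩb hKc hK0 hr.le v).trans hvt
      rw [hAe r hr, ← ENNReal.ofReal_add (hA0 r) (by positivity)] at h1
      exact (ENNReal.ofReal_le_ofReal_iff ht).1 h1
  have hstep : ∀ r r', 1 < r → r ≤ r' →
      (A r - V / r) + ‖u r - u r'‖ ^ 2 / 2 ≤ A r' - V / r' := fun r r' hr hrr' => by
    have hr0 : 0 < r := by linarith
    have hi : 0 ≤ 1 / r - 1 / r' := sub_nonneg.2 (one_div_le_one_div_of_le hr0 hrr')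
    have h1 := powerFidelity_le_add (K := K) (ubar := ubar) hΩb hr.le hrr' (u r')
    rw [hAe r' (hr.trans_le hrr'), hVe, ← ENNReal.ofReal_mul hi,
      ← ENNReal.ofReal_add (hA0 _) (by positivity)] at h1
    have h2 := hgap r hr (u r') _ (add_nonneg (hA0 _) (by positivity)) h1
    have h3 : (1 / r - 1 / r') * V = V / r - V / r' := by ring
    linarith
  set m : ℝ → ℝ := fun r => A (max r 2) - V / max r 2 with hm
  have hmax : ∀ r : ℝ, 1 < max r 2 := fun r => one_lt_two.trans_le (le_max_right _ _)
  have hmmono : Monotone m := fun r r' hrr' => by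
    have h1 := hstep _ _ (hmax r) (max_le_max_right 2 hrr')
    have h2 : 0 ≤ ‖u (max r 2) - u (max r' 2)‖ ^ 2 := sq_nonneg _
    simp only [hm]; linarith
  have hmbdd : BddAbove (range m) := by
    refine ⟨‖ubar‖ ^ 2, ?_⟩
    rintro _ ⟨r, rfl⟩
    have hr0 : 0 < max r 2 := by linarith [hmax r]
    have h1 := powerFidelity_zero_le (ubar := ubar) hN hΩ hΩb hK0 (hmax r).le
    rw [hVe, ← ENNReal.ofReal_mul (by positivity), ← ENNReal.ofReal_add (by positivity)
      (by positivity)] at h1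
    have h2 := hgap _ (hmax r) 0 _ (by positivity) h1
    have h3 : 0 ≤ ‖u (max r 2) - 0‖ ^ 2 := sq_nonneg _
    have h4 : 1 / max r 2 * V = V / max r 2 := by ring
    simp only [hm]; linarith
  set S := ⨆ r, m r with hS
  have hmS : Tendsto m atTop (𝓝 S) := tendsto_atTop_ciSup hmmono hmbdd
  have hmle : ∀ r, m r ≤ S := fun r => le_ciSup hmbdd r
  have hsqrt : Tendsto (fun r => √(2 * (S - m r))) atTop (𝓝 0) := by
    have : Tendsto (fun r => 2 * (S - m r)) atTop (𝓝 0) := by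
      simpa using (hmS.const_sub S).const_mul 2
    simpa using this.sqrt
  have hcau : CauchySeq fun r => u (max r 2) := by
    refine cauchySeq_of_le_tendsto_0' _ (fun r r' hrr' => ?_) hsqrt
    rw [dist_eq_norm]
    refine Real.le_sqrt_of_sq_le ?_
    have h1 := hstep _ _ (hmax r) (max_le_max_right 2 hrr')
    have h2 := hmle r'
    simp only [hm] at h2 ⊢
    linarith
  obtain ⟨u₀, hu₀⟩ := cauchySeq_tendsto_of_complete hcau
  have hev : (fun r => u (max r 2)) =ᶠ[atTop] u := by
    filter_upwards [eventually_ge_atTop 2] with r hr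
    rw [max_eq_left hr]
  have hlim : Tendsto u atTop (𝓝 u₀) := hu₀.congr' hev
  have hmV : Tendsto (fun r => m r + V / r) atTop (𝓝 S) := by
    simpa using hmS.add (tendsto_const_nhds.div_atTop tendsto_id (a := V))
  have hmA : ∀ r, 2 ≤ r → m r + V / r = A r := fun r hr => by
    simp only [hm, max_eq_left hr]; ring
  have hS0 : 0 ≤ S := ge_of_tendsto hmV (by
    filter_upwards [eventually_ge_atTop 2] with r hr
    rw [hmA r hr]; exact hA0 r)
  have hAS : Tendsto (fun r => powerFidelity Ω K ubar r (u r)) atTop (𝓝 (ENNReal.ofReal S)) := by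
    refine (ENNReal.tendsto_ofReal hmV).congr' ?_
    filter_upwards [eventually_ge_atTop 2] with r hr
    rw [hAe r (by linarith), hmA r hr]
  have hJ₀ : constraintFidelity Ω K ubar s u₀ ≤ ENNReal.ofReal S :=
    (constraintFidelity_le_liminf hN hΩ hΩb hK hKc hK0 hs' hlim).trans_eq hAS.liminf_eq
  -- competitors for the limit problem are competitors for `J_r`, up to an error `|Ω| / r`
  have hcomp : ∀ v : Lp ℝ 2 (volume.restrict Ω), constraintFidelity Ω K ubar s v ≠ ⊤ →
      ∀ r, m r + ‖u (max r 2) - v‖ ^ 2 / 2 ≤ (constraintFidelity Ω K ubar s v).toReal :=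
    fun v hv r => by
      have hadm := admissible_of_constraintFidelity_ne_top hN hΩ hΩb hK
        (Lp.memLp ubar).1.aemeasurable hs hv
      have hr0 : 0 < max r 2 := by linarith [hmax r]
      have h1 := hadm.energy_le (ℓ := fun x s => (s - ubar x) ^ 2) (hmax r).le
      rw [← powerFidelity_eq_energy, ← hadm.constraintFidelity_eq _ hs', hVe,
        ← ENNReal.ofReal_mul (by positivity), ← ENNReal.ofReal_toReal hv,
        ← ENNReal.ofReal_add ENNReal.toReal_nonneg (by positivity)] at h1
      have h2 := hgap _ (hmax r) v _ (add_nonneg ENNReal.toReal_nonneg (by positivity)) h1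
      have h3 : 1 / max r 2 * V = V / max r 2 := by ring
      simp only [hm]; linarith
  refine ⟨u₀, fun v => ?_, fun v hv => ?_⟩
  · change constraintFidelity Ω K ubar s u₀ ≤ constraintFidelity Ω K ubar s v
    by_cases hvt : constraintFidelity Ω K ubar s v = ⊤
    · rw [hvt]; exact le_top
    · refine hJ₀.trans (ENNReal.ofReal_le_of_le_toReal ?_)
      refine ciSup_le fun r => ?_
      have h1 := hcomp v hvt r
      have h2 : 0 ≤ ‖u (max r 2) - v‖ ^ 2 := sq_nonneg _
      linarith
  · have hvS : constraintFidelity Ω K ubar s v ≤ ENNReal.ofReal S := (hv u₀).trans hJ₀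
    have hvt : constraintFidelity Ω K ubar s v ≠ ⊤ :=
      ne_top_of_le_ne_top ENNReal.ofReal_ne_top hvS
    refine Tendsto.congr' hev (tendsto_iff_dist_tendsto_zero.2 ?_)
    refine squeeze_zero (fun _ => dist_nonneg) (fun r => ?_) hsqrt
    rw [dist_eq_norm]
    refine Real.le_sqrt_of_sq_le ?_
    have h1 := hcomp v hvt r
    have h2 : (constraintFidelity Ω K ubar s v).toReal ≤ S :=
      ENNReal.toReal_le_of_le_ofReal hS0 hvS
    linarith

end Minimizers
end SobolevGamma

namespace SobolevGamma

variable {N : ℕ} {Ω K : Set (EuclideanSpace ℝ (Fin N))} {p q : ℝ≥0∞}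

/-! ### Weak convergence of the minimizers -/

lemma tendsto_toWeakSpace_of_forall {E ι : Type*} [NormedAddCommGroup E] [NormedSpace ℝ E]
    {l : Filter ι} {w : ι → E} {w₀ : E}
    (h : ∀ L : StrongDual ℝ E, Tendsto (fun i => L (w i)) l (𝓝 (L w₀))) :
    Tendsto (fun i => toWeakSpace ℝ E (w i)) l (𝓝 (toWeakSpace ℝ E w₀)) := by
  have hind : IsInducing (fun (x : WeakSpace ℝ E) (L : StrongDual ℝ E) =>
      L ((toWeakSpace ℝ E).symm x)) := ⟨rfl⟩
  refine hind.tendsto_nhds_iff.2 (tendsto_pi_nhds.2 fun L => ?_)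
  simpa using h L

section WeakConvergence

variable {r : ℝ}

/-- Boundedness of the energies upgrades convergence in `L^p(Ω)` to weak convergence in
`W^{1,r}_0(Ω)`: half-spaces are closed and convex, so a weak limit point of a subsequence would
violate the inequality `ℓ(w) < a`. -/
lemma weakTendstoSobolevZero_of_energy_le (hN : 0 < N) (hΩ : IsOpen Ω)
    (hΩb : Bornology.IsBounded Ω) (hK : IsCompact K) (hKc : Convex ℝ K) (hK0 : 0 ∈ interior K)
    [Fact (1 ≤ p)] (hr : 1 < r) [Fact (1 ≤ ENNReal.ofReal r)] {c : ℝ≥0∞} (hc : c ≠ ⊤)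
    {u : ℝ → Lp ℝ p (volume.restrict Ω)} {u₀ : Lp ℝ p (volume.restrict Ω)}
    (hu : Tendsto u atTop (𝓝 u₀))
    (huc : ∀ᶠ t in atTop, energy Ω K (fun _ _ => 0) r (u t) ≤ c) :
    WeakTendstoSobolevZero Ω (ENNReal.ofReal r) atTop (fun t => u t) u₀ := by
  classical
  have : IsFiniteMeasure (volume.restrict Ω) := ⟨by simpa using hΩb.measure_lt_top⟩
  set h : EuclideanSpace ℝ (Fin N) → ℝ → EuclideanSpace ℝ (Fin N) → ℝ :=
    fun _ _ ξ => 1 / r * gauge K ξ ^ r + 0 with hh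
  have h₀ : energy Ω K (fun _ _ => 0) r u₀ ≤ c := by
    obtain ⟨e, he, hec⟩ := exists_seq_forall_of_frequently huc.frequently
    exact energy_le_of_tendsto hN hΩ hΩb hK hKc hK0 (fun _ _ => le_rfl) (isConvexIntegrand_zero _)
      hr hc (.of_forall hec) (Lp.memLp u₀).1.aemeasurable (tendsto_lintegral_abs_sub (hu.comp he))
  obtain ⟨w₀, hw₀, -⟩ := exists_lagrangian_eq_energy hΩ (ne_top_of_le_ne_top hc h₀)
  set w : ℝ → sobolevZero Ω (ENNReal.ofReal r) := fun t =>
    if ht : ∃ w : sobolevZero Ω (ENNReal.ofReal r), w.1.1 =ᵐ[volume.restrict Ω] u t ∧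
      lagrangian h w ≤ c then ht.choose else 0 with hw
  have hwev : ∀ᶠ t in atTop, (w t).1.1 =ᵐ[volume.restrict Ω] u t ∧ lagrangian h (w t) ≤ c := by
    filter_upwards [huc] with t ht
    obtain ⟨z, hz1, hz2⟩ := exists_lagrangian_eq_energy hΩ (ne_top_of_le_ne_top hc ht)
    have hex : ∃ w : sobolevZero Ω (ENNReal.ofReal r), w.1.1 =ᵐ[volume.restrict Ω] u t ∧
      lagrangian h w ≤ c := ⟨z, hz1, hz2.trans_le ht⟩
    simp only [hw, dif_pos hex]
    exact hex.choose_spec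
  have key : ∀ (L : StrongDual ℝ (sobolevZero Ω (ENNReal.ofReal r))) (a : ℝ), L w₀ < a →
      ∀ᶠ t in atTop, L (w t) < a := fun L a ha => by
    by_contra hcon
    rw [not_eventually] at hcon
    obtain ⟨e, he, hec⟩ := exists_seq_forall_of_frequently (hcon.and_eventually hwev)
    obtain ⟨y, hy, hyC⟩ := exists_weak_limit_of_tendsto (ℓ := fun _ _ => 0) hN hΩ hΩb hK hK0
      (fun _ _ => le_rfl) hr hc (fun n => (hec n).2.2) (Lp.memLp u₀).1.aemeasurable (by
        refine (tendsto_lintegral_abs_sub (hu.comp he)).congr fun n => lintegral_congr_ae ?_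
        filter_upwards [(hec n).2.1] with x hx
        rw [hx, Function.comp])
    have hyw : y = w₀ := sobolevZero_ext hΩ (Lp.ext (hy.trans hw₀.symm))
    have := hyC {z | a ≤ L z} (convex_halfSpace_ge L.isLinear a)
      (isClosed_le continuous_const L.continuous) (.of_forall fun n => not_lt.1 (hec n).1)
    rw [hyw] at this
    exact absurd ha (not_lt.2 this)
  refine ⟨w, w₀, hwev.mono fun t ht => ht.1, hw₀, ?_⟩
  refine tendsto_toWeakSpace_of_forall fun L =>
    tendsto_order.2 ⟨fun a ha => ?_, fun a ha => key L a ha⟩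
  filter_upwards [key (-L) (-a) (neg_lt_neg ha)] with t ht
  exact neg_lt_neg_iff.1 ht

/-- For `p ≥ q` the energies of exponent `q` of the minimizers `u_p` are bounded independently of
`p`, by comparison with `J_p(0)`. -/
theorem weakTendstoSobolevZero_minimizers (hN : 0 < N) (hΩ : IsOpen Ω)
    (hΩb : Bornology.IsBounded Ω) (hK : IsCompact K) (hKc : Convex ℝ K) (hK0 : 0 ∈ interior K)
    {ubar : Lp ℝ 2 (volume.restrict Ω)} {u : ℝ → Lp ℝ 2 (volume.restrict Ω)}
    {u₀ : Lp ℝ 2 (volume.restrict Ω)}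
    (hu : ∀ r, 1 < r → IsMinimizer
      (fun w : Lp ℝ 2 (volume.restrict Ω) => powerFidelity Ω K ubar r w) (u r))
    (hlim : Tendsto u atTop (𝓝 u₀)) [Fact (1 ≤ q)] (hq : 1 < q) (hq' : q ≠ ⊤) :
    WeakTendstoSobolevZero Ω q atTop (fun r => u r) u₀ := by
  have : IsFiniteMeasure (volume.restrict Ω) := ⟨by simpa using hΩb.measure_lt_top⟩
  have hV := (hΩb.measure_lt_top (μ := volume)).ne
  obtain ⟨r, rfl⟩ : ∃ r : ℝ, q = ENNReal.ofReal r := ⟨q.toReal, (ENNReal.ofReal_toReal hq').symm⟩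
  have hr : 1 < r := ENNReal.one_lt_ofReal.1 hq
  have hone : ∀ t : ℝ, 1 ≤ t → ENNReal.ofReal (1 / t) ≤ 1 := fun t ht =>
    ENNReal.ofReal_le_one.2 ((div_le_one (by linarith)).2 ht)
  refine weakTendstoSobolevZero_of_energy_le (c := ENNReal.ofReal (‖ubar‖ ^ 2) + volume Ω + volume Ω)
    hN hΩ hΩb hK hKc hK0 hr (by finiteness) hlim ?_
  filter_upwards [eventually_ge_atTop r] with t ht
  have ht1 : 1 < t := hr.trans_le ht
  calc energy Ω K (fun _ _ => 0) r (u t) ≤ powerFidelity Ω K ubar r (u t) := by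
        rw [powerFidelity_eq_energy]
        exact energy_zero_le fun _ _ => sq_nonneg _
    _ ≤ powerFidelity Ω K ubar t (u t) + ENNReal.ofReal (1 / r - 1 / t) * volume Ω :=
        powerFidelity_le_add hΩb hr.le ht _
    _ ≤ (ENNReal.ofReal (‖ubar‖ ^ 2) + ENNReal.ofReal (1 / t) * volume Ω) +
          ENNReal.ofReal (1 / r) * volume Ω := by
        gcongr
        · exact (hu t ht1 0).trans (powerFidelity_zero_le hN hΩ hΩb hK0 ht1.le)
        · exact sub_le_self _ (by positivity)
    _ ≤ _ := by
        gcongr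
        · exact mul_le_of_le_one_left' (hone t ht1.le)
        · exact mul_le_of_le_one_left' (hone r hr.le)

end WeakConvergence
end SobolevGamma

open SobolevGamma in
theorem mainTheorem7 (N : ℕ) (hN : 2 ≤ N) (Ω K : Set (EuclideanSpace ℝ (Fin N)))
    (hΩ : IsOpen Ω) (hΩb : Bornology.IsBounded Ω)
    (hK : IsCompact K) (hKc : Convex ℝ K) (hK0 : (0 : EuclideanSpace ℝ (Fin N)) ∈ interior K) :
    (∀ (r : ℝ≥0∞) [Fact (1 ≤ r)],
      GammaTendsto atTop
        (fun (p : ℝ) (v : Lp ℝ r (volume.restrict Ω)) => powerEnergy Ω K p v)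
        (fun v : Lp ℝ r (volume.restrict Ω) => constraintEnergy Ω K v)) ∧
    (∀ (ubar : Lp ℝ 2 (volume.restrict Ω)) (s : ℝ≥0∞),
      (s = ⊤ ∨ (s = 1 ∧ ThickComplement Ω)) →
      GammaTendsto atTop
        (fun (p : ℝ) (v : Lp ℝ 2 (volume.restrict Ω)) => powerFidelity Ω K ubar p v)
        (fun v : Lp ℝ 2 (volume.restrict Ω) => constraintFidelity Ω K ubar s v) ∧
      (∀ c₀ : ℝ, MemSobolevZero Ω ⊤ (fun x => ubar x - c₀) →
        (∀ᵐ x ∂(volume.restrict Ω), gauge K (weakGradient Ω ubar x) ≤ 1) →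
        (∀ p : ℝ, 1 < p → ∃! v : Lp ℝ 2 (volume.restrict Ω),
          IsMinimizer (fun w : Lp ℝ 2 (volume.restrict Ω) => powerFidelity Ω K ubar p w) v) ∧
        (∃! v : Lp ℝ 2 (volume.restrict Ω),
          IsMinimizer
            (fun w : Lp ℝ 2 (volume.restrict Ω) => constraintFidelity Ω K ubar s w) v) ∧
        (∀ (u : ℝ → Lp ℝ 2 (volume.restrict Ω)) (u₀ : Lp ℝ 2 (volume.restrict Ω)),
          (∀ p : ℝ, 1 < p →
            IsMinimizer
              (fun w : Lp ℝ 2 (volume.restrict Ω) => powerFidelity Ω K ubar p w) (u p)) →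
          IsMinimizer
            (fun w : Lp ℝ 2 (volume.restrict Ω) => constraintFidelity Ω K ubar s w) u₀ →
          ∀ (q : ℝ≥0∞) [Fact (1 ≤ q)], 1 < q → q ≠ ⊤ →
            WeakTendstoSobolevZero Ω q atTop (fun p => u p) u₀))) := by
  have hN0 : 0 < N := by omega
  refine ⟨fun r _ => gammaTendsto_powerEnergy hN0 hΩ hΩb hK hKc hK0, fun ubar s hs =>
    ⟨gammaTendsto_powerFidelity hN0 hΩ hΩb hK hKc hK0 hs, fun _ _ _ => ?_⟩⟩
  have hex := fun (p : ℝ) (hp : 1 < p) => existsUnique_isMinimizer_powerFidelity (ubar := ubar)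
    hN0 hΩ hΩb hK hKc hK0 hp
  refine ⟨hex, ?_, fun u u₀ hu hu₀ q _ hq hq' => ?_⟩
  · choose! u hu _ using hex
    obtain ⟨u₀, hu₀, hlim⟩ :=
      exists_isMinimizer_constraintFidelity hN0 hΩ hΩb hK hKc hK0 hs hu
    exact ⟨u₀, hu₀, fun v hv => tendsto_nhds_unique (hlim v hv) (hlim u₀ hu₀)⟩
  · obtain ⟨-, -, hlim⟩ := exists_isMinimizer_constraintFidelity hN0 hΩ hΩb hK hKc hK0 hs hu
    exact weakTendstoSobolevZero_minimizers hN0 hΩ hΩb hK hKc hK0 hu (hlim u₀ hu₀) hq hq'
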